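/- Let $0<T<\infty$ and let $\eta,u$ be three times continuously differentiable on $[0,1]\times[0,T]$. Suppose that on $[0,1]\times[0,T]$ the pair $(\eta,u)$ solves either (CB): $\ \eta_t+u_x+(\eta u)_x=0,\quad u_t+\eta_x+uu_x-\tfrac13u_{xxt}=0,$ or (SCB): $\ \eta_t+u_x+\tfrac12(\eta u)_x=0,\quad u_t+\eta_x+\tfrac32uu_x+\tfrac12\eta\eta_x-\tfrac13u_{xxt}=0,$ with $\eta(\cdot,0)=\eta_0$, $u(\cdot,0)=u_0$ and $u(0,t)=u(1,t)=0$ for $0\le t\le T$. For integers $N\ge2$, $M\ge1$ put $h=1/N$, $k=T/M$, $t^n=nk$. Let $S_h$ be the space of continuous functions on $[0,1]$ that are affine on each $[jh,(j+1)h]$, $0\le j<N$, and $S_{h,0}=\{\chi\in S_h:\chi(0)=\chi(1)=0\}$. Write $(f,g)=\int_0^1fg\,dx$, $\|f\|=(f,f)^{1/2}$, $a(v,w)=(v,w)+\tfrac13(v',w')$ and $\|v\|_1=a(v,v)^{1/2}$. Let $H_h^n\in S_h$, $U_h^n\in S_{h,0}$ $(0\le n\le M)$ satisfy the explicit Euler--Galerkin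 scheme in which $H_h^0$, $U_h^0$ are the interpolants of $\eta_0$, $u_0$ at the nodes $ih$, $0\le i\le N$, and for $0\le n\le M-1$ and all $\phi\in S_h$, $\chi\in S_{h,0}$, in the case of (CB), $$(H_h^{n+1}-H_h^n,\phi)+k(U_{hx}^n,\phi)+k((H_h^nU_h^n)_x,\phi)=0,$$ $$a(U_h^{n+1}-U_h^n,\chi)+k(H_{hx}^n,\chi)+k(U_h^nU_{hx}^n,\chi)=0,$$ and, in the case of (SCB), $$(H_h^{n+1}-H_h^n,\phi)+k(U_{hx}^n,\phi)+\tfrac k2((H_h^nU_h^n)_x,\phi)=0,$$ $$a(U_h^{n+1}-U_h^n,\chi)+k(H_{hx}^n,\chi)+\tfrac{3k}2(U_h^nU_{hx}^n,\chi)+\tfrac k2(H_h^nH_{hx}^n,\chi)=0.$$ Then, in each of the two cases, there is a continuous, strictly increasing function $C:[0,\infty)\to\mathbb R$, independent of $N$ and $M$, such that for every $\mu_0>0$ there is $h_0>0$ with the following property: whenever $h\le h_0$ and $\mu:=k/h^2\le\mu_0$, $$\max_{0\le n\le M}\|H_h^n-\eta(\cdot,t^n)\|\le C(\mu)\,(k+h^{3/2}),\qquad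 \max_{0\le n\le M}\|U_h^n-u(\cdot,t^n)\|_1\le C(\mu)\,(k+h).$$ -/

import Mathlib

open Set

noncomputable section

namespace Boussinesq

/-- Partial derivative in `x` on the spatial interval `[0,1]` (one-sided at the end points). -/
def dx (f : ℝ → ℝ → ℝ) : ℝ → ℝ → ℝ :=
  fun x t => derivWithin (fun y => f y t) (Icc 0 1) x

/-- Partial derivative in `t` on the time interval `[0,T]` (one-sided at the end points). -/
def dt (T : ℝ) (f : ℝ → ℝ → ℝ) : ℝ → ℝ → ℝ :=
  fun x t => derivWithin (fun s => f x s) (Icc 0 T) t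

/-- `(η, u)`, as functions of `(x, t)`, is a classical solution of the initial-boundary-value problem
(CB) for the 'classical' Boussinesq system on `[0,1] × [0,T]`. -/
structure IsSolutionCB (T : ℝ) (η₀ u₀ : ℝ → ℝ) (η u : ℝ → ℝ → ℝ) : Prop where
  mass : ∀ x ∈ Icc (0 : ℝ) 1, ∀ t ∈ Icc 0 T,
    dt T η x t + dx u x t + dx (fun y s => η y s * u y s) x t = 0
  momentum : ∀ x ∈ Icc (0 : ℝ) 1, ∀ t ∈ Icc 0 T,
    dt T u x t + dx η x t + u x t * dx u x t - (1 / 3) * dt T (dx (dx u)) x t = 0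
  init_η : ∀ x ∈ Icc (0 : ℝ) 1, η x 0 = η₀ x
  init_u : ∀ x ∈ Icc (0 : ℝ) 1, u x 0 = u₀ x
  bdry_left : ∀ t ∈ Icc 0 T, u 0 t = 0
  bdry_right : ∀ t ∈ Icc 0 T, u 1 t = 0

/-- `(η, u)`, as functions of `(x, t)`, is a classical solution of the initial-boundary-value problem
(SCB) for the symmetric system on `[0,1] × [0,T]`. -/
structure IsSolutionSCB (T : ℝ) (η₀ u₀ : ℝ → ℝ) (η u : ℝ → ℝ → ℝ) : Prop where
  mass : ∀ x ∈ Icc (0 : ℝ) 1, ∀ t ∈ Icc 0 T,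
    dt T η x t + dx u x t + (1 / 2) * dx (fun y s => η y s * u y s) x t = 0
  momentum : ∀ x ∈ Icc (0 : ℝ) 1, ∀ t ∈ Icc 0 T,
    dt T u x t + dx η x t + (3 / 2) * (u x t * dx u x t) + (1 / 2) * (η x t * dx η x t)
      - (1 / 3) * dt T (dx (dx u)) x t = 0
  init_η : ∀ x ∈ Icc (0 : ℝ) 1, η x 0 = η₀ x
  init_u : ∀ x ∈ Icc (0 : ℝ) 1, u x 0 = u₀ x
  bdry_left : ∀ t ∈ Icc 0 T, u 0 t = 0
  bdry_right : ∀ t ∈ Icc 0 T, u 1 t = 0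

/-- The space `S_h²` of continuous functions on `[0,1]` that are affine on each cell
`[j/N, (j+1)/N]` of the uniform mesh with `h = 1/N`. (Values outside `[0,1]` are irrelevant.) -/
def S (N : ℕ) : Set (ℝ → ℝ) :=
  {φ | ContinuousOn φ (Icc 0 1) ∧
    ∀ j < N, ∃ a b : ℝ, ∀ x ∈ Icc ((j : ℝ) / N) (((j : ℝ) + 1) / N), φ x = a * x + b}

/-- The subspace `S_{h,0}²` of the elements of `S_h²` that vanish at `0` and `1`. -/
def S0 (N : ℕ) : Set (ℝ → ℝ) :=
  {φ | φ ∈ S N ∧ φ 0 = 0 ∧ φ 1 = 0}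

/-- `v` and `w` agree at the nodes `x_i = i/N`, `0 ≤ i ≤ N`. For `v` in `S N` (or `S0 N`) this says
that `v` is the piecewise linear interpolant of `w` in that space. -/
def AgreesAtNodes (N : ℕ) (v w : ℝ → ℝ) : Prop :=
  ∀ i ≤ N, v ((i : ℝ) / N) = w ((i : ℝ) / N)

/-- The `L²(0,1)` inner product. -/
def ip (f g : ℝ → ℝ) : ℝ := ∫ x in (0 : ℝ)..1, f x * g x

/-- The `L²(0,1)` norm. -/
def normL2 (f : ℝ → ℝ) : ℝ := Real.sqrt (ip f f)

/-- The bilinear form `a(v, w) = (v, w) + (1/3)(v', w')`. It is applied to continuous functions that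
are `C¹` on each cell of a mesh; for those `deriv` is the weak derivative almost everywhere. -/
def a (v w : ℝ → ℝ) : ℝ := ip v w + (1 / 3) * ip (deriv v) (deriv w)

/-- The norm `‖v‖₁ = (‖v‖² + (1/3)‖v'‖²)^{1/2}` on `H¹(0,1)`. -/
def normH1 (v : ℝ → ℝ) : ℝ := Real.sqrt (a v v)

/-- `(H n, U n)`, `0 ≤ n ≤ M`, is produced by the explicit Euler / piecewise linear Galerkin scheme
for (CB) with mesh length `1/N`, time step `k` and initial data `η₀`, `u₀`. -/
structure IsEulerCB (N M : ℕ) (k : ℝ) (η₀ u₀ : ℝ → ℝ) (H U : ℕ → ℝ → ℝ) : Prop where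
  H_mem : ∀ n ≤ M, H n ∈ S N
  U_mem : ∀ n ≤ M, U n ∈ S0 N
  init_H : AgreesAtNodes N (H 0) η₀
  init_U : AgreesAtNodes N (U 0) u₀
  step_H : ∀ n < M, ∀ φ ∈ S N,
    ip (H (n + 1) - H n) φ + k * ip (deriv (U n)) φ + k * ip (deriv (H n * U n)) φ = 0
  step_U : ∀ n < M, ∀ χ ∈ S0 N,
    a (U (n + 1) - U n) χ + k * ip (deriv (H n)) χ + k * ip (U n * deriv (U n)) χ = 0

/-- `(H n, U n)`, `0 ≤ n ≤ M`, is produced by the explicit Euler / piecewise linear Galerkin scheme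
for (SCB) with mesh length `1/N`, time step `k` and initial data `η₀`, `u₀`. -/
structure IsEulerSCB (N M : ℕ) (k : ℝ) (η₀ u₀ : ℝ → ℝ) (H U : ℕ → ℝ → ℝ) : Prop where
  H_mem : ∀ n ≤ M, H n ∈ S N
  U_mem : ∀ n ≤ M, U n ∈ S0 N
  init_H : AgreesAtNodes N (H 0) η₀
  init_U : AgreesAtNodes N (U 0) u₀
  step_H : ∀ n < M, ∀ φ ∈ S N,
    ip (H (n + 1) - H n) φ + k * ip (deriv (U n)) φ + k / 2 * ip (deriv (H n * U n)) φ = 0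
  step_U : ∀ n < M, ∀ χ ∈ S0 N,
    a (U (n + 1) - U n) χ + k * ip (deriv (H n)) χ + 3 * k / 2 * ip (U n * deriv (U n)) χ
      + k / 2 * ip (H n * deriv (H n)) χ = 0

end Boussinesq

end

/-!
Both systems belong to the family `η_t + ((1 + α η) u)_x = 0`,
`(u - u_xx / 3)_t + (η + β u² / 2 + γ η² / 2)_x = 0`, and the scheme is analysed for the whole family
(`IsSolution`, `IsEuler`). The discrete solution is compared with the piecewise linear interpolants
of the exact one: `θ = H - I η` and `ξ = U - I u`, both zero at time zero.

* Mass balance (`MassStep`). Tested with a piecewise linear `φ`, the flux of the interpolants differs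
  from the exact flux by a function which vanishes at the nodes, is `O(h²)`, and whose cell averages
  vary by only `O(h³)` between neighbouring cells of the uniform mesh. Summation by parts leaves two
  boundary terms of size `h² max |φ|`, and the inverse inequality `max |φ| ≤ 2 h^{-1/2} ‖φ‖` gives
  the order `h^{3/2}` (`abs_ip_flux_error_le`). The transport term `((θ U)_x, θ) = (U_x, θ²) / 2`
  does not lose a derivative, and an inverse inequality bounds the increment of `θ` by
  `O((k / h) ‖θ‖)` plus terms without negative powers of `h`.
* Momentum balance (`MomentumStep`). The form `a` controls the derivative of the test function, so
  the gradient terms are integrated by parts onto it, and the interpolation error is orthogonal to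
  piecewise linear functions in the `H¹` seminorm.
* Accumulation (`energy_step`, `energy_bound`). The squared increment of `θ` contributes
  `(k / h)² ‖θ‖² = k μ ‖θ‖²`, so `‖θ‖² + ‖ξ‖₁²` grows at a rate which is affine in `μ = k / h²`; this
  is where the dependence of the constant on `μ` comes from. The cubic terms are controlled by the
  bootstrap assumption `|θ|, |ξ| ≤ 1`, which the error bound itself provides, through the inverse
  inequality, as soon as `h` is small compared with a constant depending on the bound `μ₀` of `μ`.
-/

noncomputable section
namespace Boussinesq
open MeasureTheory

/-! ### Essentially bounded functions and the inner product of `L²(0,1)` -/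

/-- Lebesgue measure on the unit interval. -/
abbrev unitVol : Measure ℝ := volume.restrict (Ioc 0 1)

/-- Essentially bounded measurable functions on `(0,1)`. All functions paired by `ip` below belong
to this class; it is an algebra and embeds in `L¹`. -/
def EssBdd (f : ℝ → ℝ) : Prop := MemLp f ⊤ unitVol

lemma EssBdd.add {f g : ℝ → ℝ} (hf : EssBdd f) (hg : EssBdd g) : EssBdd (f + g) := MemLp.add hf hg

lemma EssBdd.sub {f g : ℝ → ℝ} (hf : EssBdd f) (hg : EssBdd g) : EssBdd (f - g) := MemLp.sub hf hg

lemma EssBdd.mul {f g : ℝ → ℝ} (hf : EssBdd f) (hg : EssBdd g) : EssBdd (f * g) :=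
  MemLp.mul (p := ⊤) (q := ⊤) (r := ⊤) hg hf

lemma EssBdd.smul {f : ℝ → ℝ} (c : ℝ) (hf : EssBdd f) : EssBdd (c • f) := MemLp.const_smul hf c

lemma EssBdd.integrable {f : ℝ → ℝ} (hf : EssBdd f) : Integrable f unitVol :=
  MemLp.integrable le_top hf

lemma EssBdd.of_bound {f : ℝ → ℝ} (hf : AEStronglyMeasurable f unitVol) (K : ℝ)
    (h : ∀ᵐ x ∂unitVol, |f x| ≤ K) : EssBdd f :=
  memLp_top_of_bound hf K h

lemma EssBdd.congr {f g : ℝ → ℝ} (hf : EssBdd f) (h : f =ᵐ[unitVol] g) : EssBdd g :=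
  (memLp_congr_ae h).1 hf

/-- Removing the end points and a countable set does not affect almost-everywhere statements. -/
lemma ae_of_off_countable {p : ℝ → Prop} {s : Set ℝ} (hs : s.Countable)
    (h : ∀ x ∈ Ioo (0 : ℝ) 1 \ s, p x) : ∀ᵐ x ∂unitVol, p x := by
  rw [ae_restrict_iff' measurableSet_Ioc]
  have h1 : ∀ᵐ x : ℝ, x ∉ s := hs.ae_notMem volume
  have h2 : ∀ᵐ x : ℝ, x ∉ ({1} : Set ℝ) := (countable_singleton 1).ae_notMem volume
  filter_upwards [h1, h2] with x hx1 hx2 hx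
  exact h x ⟨⟨hx.1, lt_of_le_of_ne hx.2 hx2⟩, hx1⟩

lemma ae_of_Ioo {p : ℝ → Prop} (h : ∀ x ∈ Ioo (0 : ℝ) 1, p x) : ∀ᵐ x ∂unitVol, p x :=
  ae_of_off_countable countable_empty fun x hx => h x hx.1

lemma ae_of_Icc {p : ℝ → Prop} (h : ∀ x ∈ Icc (0 : ℝ) 1, p x) : ∀ᵐ x ∂unitVol, p x :=
  ae_of_Ioo fun x hx => h x (Ioo_subset_Icc_self hx)

lemma EssBdd.of_continuousOn {f : ℝ → ℝ} (hf : ContinuousOn f (Icc 0 1)) : EssBdd f := by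
  obtain ⟨K, hK⟩ := isCompact_Icc.exists_bound_of_continuousOn hf
  refine EssBdd.of_bound ((hf.mono Ioc_subset_Icc_self).aestronglyMeasurable measurableSet_Ioc) K ?_
  exact ae_of_Ioo fun x hx => hK x (Ioo_subset_Icc_self hx)

lemma ip_eq_integral (f g : ℝ → ℝ) : ip f g = ∫ x, f x * g x ∂unitVol := by
  rw [ip, intervalIntegral.integral_of_le zero_le_one]

lemma ip_congr {f f' g g' : ℝ → ℝ} (hf : f =ᵐ[unitVol] f') (hg : g =ᵐ[unitVol] g') :
    ip f g = ip f' g' := by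
  rw [ip_eq_integral, ip_eq_integral]
  refine integral_congr_ae ?_
  filter_upwards [hf, hg] with x h1 h2
  rw [h1, h2]

lemma ip_comm (f g : ℝ → ℝ) : ip f g = ip g f := by
  simp only [ip, mul_comm]

lemma ip_add_left {f g w : ℝ → ℝ} (hf : EssBdd f) (hg : EssBdd g) (hw : EssBdd w) :
    ip (f + g) w = ip f w + ip g w := by
  simp only [ip_eq_integral]
  refine (integral_congr_ae (ae_of_all _ fun x => ?_)).trans
    (integral_add (hf.mul hw).integrable (hg.mul hw).integrable)
  simp [add_mul]

lemma ip_sub_left {f g w : ℝ → ℝ} (hf : EssBdd f) (hg : EssBdd g) (hw : EssBdd w) :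
    ip (f - g) w = ip f w - ip g w := by
  simp only [ip_eq_integral]
  refine (integral_congr_ae (ae_of_all _ fun x => ?_)).trans
    (integral_sub (hf.mul hw).integrable (hg.mul hw).integrable)
  simp [sub_mul]

lemma ip_smul_left (c : ℝ) (f w : ℝ → ℝ) : ip (c • f) w = c * ip f w := by
  simp only [ip_eq_integral]
  rw [← integral_const_mul]
  simp [mul_assoc]

lemma ip_add_right {f g w : ℝ → ℝ} (hf : EssBdd f) (hg : EssBdd g) (hw : EssBdd w) :
    ip w (f + g) = ip w f + ip w g := by
  rw [ip_comm, ip_add_left hf hg hw, ip_comm f, ip_comm g]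

lemma ip_smul_right (c : ℝ) (f w : ℝ → ℝ) : ip w (c • f) = c * ip w f := by
  rw [ip_comm, ip_smul_left, ip_comm]

lemma ip_mul_assoc (f g w : ℝ → ℝ) : ip (f * g) w = ip f (g * w) := by
  simp [ip, mul_assoc]

lemma ip_self_nonneg (f : ℝ → ℝ) : 0 ≤ ip f f := by
  rw [ip_eq_integral]
  exact integral_nonneg fun x => mul_self_nonneg _

lemma normL2_nonneg (f : ℝ → ℝ) : 0 ≤ normL2 f := Real.sqrt_nonneg _

lemma normL2_sq (f : ℝ → ℝ) : normL2 f ^ 2 = ip f f := Real.sq_sqrt (ip_self_nonneg f)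

lemma normL2_congr {f g : ℝ → ℝ} (h : f =ᵐ[unitVol] g) : normL2 f = normL2 g := by
  rw [normL2, normL2, ip_congr h h]

/-- The Cauchy–Schwarz inequality for the quadratic polynomial `A + 2 B t + C t²`. -/
lemma abs_le_sqrt_mul_sqrt {A B C : ℝ} (hA : 0 ≤ A) (h : ∀ t : ℝ, 0 ≤ A + 2 * B * t + C * t ^ 2) :
    |B| ≤ √A * √C := by
  have h1 : discrim C (2 * B) A ≤ 0 := discrim_le_zero fun t => by
    have := h t
    nlinarith
  rw [discrim] at h1
  rw [← Real.sqrt_mul hA]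
  exact Real.abs_le_sqrt (by nlinarith)

lemma abs_ip_le {f g : ℝ → ℝ} (hf : EssBdd f) (hg : EssBdd g) :
    |ip f g| ≤ normL2 f * normL2 g := by
  refine abs_le_sqrt_mul_sqrt (ip_self_nonneg f) fun t => ?_
  have h := ip_self_nonneg (f + t • g)
  rw [ip_add_left hf (hg.smul t) (hf.add (hg.smul t)), ip_smul_left,
    ip_add_right hf (hg.smul t) hf, ip_add_right hf (hg.smul t) hg, ip_smul_right, ip_smul_right,
    ip_comm g f] at h
  nlinarith

lemma normL2_add_le {f g : ℝ → ℝ} (hf : EssBdd f) (hg : EssBdd g) :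
    normL2 (f + g) ≤ normL2 f + normL2 g := by
  refine abs_le_of_sq_le_sq' ?_ (add_nonneg (normL2_nonneg _) (normL2_nonneg _)) |>.2
  rw [normL2_sq, ip_add_left hf hg (hf.add hg), ip_add_right hf hg hf, ip_add_right hf hg hg,
    ip_comm g f]
  have := (abs_le.1 (abs_ip_le hf hg)).2
  nlinarith [normL2_sq f, normL2_sq g]

lemma normL2_smul (c : ℝ) (f : ℝ → ℝ) : normL2 (c • f) = |c| * normL2 f := by
  rw [normL2, ip_smul_left, ip_smul_right, ← mul_assoc, Real.sqrt_mul (mul_self_nonneg c),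
    Real.sqrt_mul_self_eq_abs, normL2]

lemma normL2_mono {f g : ℝ → ℝ} (hg : EssBdd g) (hf : EssBdd f)
    (h : ∀ᵐ x ∂unitVol, |f x| ≤ |g x|) : normL2 f ≤ normL2 g := by
  refine Real.sqrt_le_sqrt ?_
  rw [ip_eq_integral, ip_eq_integral]
  refine integral_mono_ae (hf.mul hf).integrable (hg.mul hg).integrable ?_
  filter_upwards [h] with x hx
  have := sq_le_sq.2 hx
  simpa [pow_two] using this

/-- A multiplication operator is bounded on `L²` by the supremum of its symbol. -/
lemma normL2_mul_le {f g : ℝ → ℝ} (hf : EssBdd f) (hg : EssBdd g) {c : ℝ} (hc : 0 ≤ c)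
    (h : ∀ᵐ x ∂unitVol, |f x| ≤ c) : normL2 (f * g) ≤ c * normL2 g := by
  rw [← abs_of_nonneg hc, ← normL2_smul]
  refine normL2_mono (hg.smul c) (hf.mul hg) ?_
  filter_upwards [h] with x hx
  simp only [Pi.mul_apply, Pi.smul_apply, smul_eq_mul, abs_mul]
  rw [abs_of_nonneg hc]
  gcongr

lemma normL2_one : normL2 1 = 1 := by simp [normL2, ip]

lemma EssBdd.one : EssBdd 1 := EssBdd.of_continuousOn continuousOn_const

lemma normL2_le_of_bound {f : ℝ → ℝ} (hf : EssBdd f) {c : ℝ} (hc : 0 ≤ c)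
    (h : ∀ᵐ x ∂unitVol, |f x| ≤ c) : normL2 f ≤ c := by
  have := normL2_mul_le hf EssBdd.one hc h
  simpa [normL2_one] using this

/-! ### Continuous functions with bounded derivative off a countable set -/

/-- Continuous functions on `[0,1]` which are differentiable with bounded derivative in the interior
except on a countable set. Both `C¹` functions and elements of `S N` are of this kind; the class is
an algebra in which integration by parts holds, and `deriv` computes the weak derivative. -/
def PwC1 (f : ℝ → ℝ) : Prop :=
  ContinuousOn f (Icc 0 1) ∧ ∃ s : Set ℝ, s.Countable ∧ ∃ K : ℝ,
    ∀ x ∈ Ioo (0 : ℝ) 1 \ s, DifferentiableAt ℝ f x ∧ |deriv f x| ≤ K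

lemma PwC1.essBdd {f : ℝ → ℝ} (hf : PwC1 f) : EssBdd f := .of_continuousOn hf.1

lemma PwC1.essBdd_deriv {f : ℝ → ℝ} (hf : PwC1 f) : EssBdd (deriv f) := by
  obtain ⟨-, s, hs, K, hK⟩ := hf
  exact EssBdd.of_bound (measurable_deriv f).aestronglyMeasurable K
    (ae_of_off_countable hs fun x hx => (hK x hx).2)

lemma PwC1.ae_differentiableAt {f : ℝ → ℝ} (hf : PwC1 f) :
    ∀ᵐ x ∂unitVol, DifferentiableAt ℝ f x := by
  obtain ⟨-, s, hs, K, hK⟩ := hf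
  exact ae_of_off_countable hs fun x hx => (hK x hx).1

lemma PwC1.add {f g : ℝ → ℝ} (hf : PwC1 f) (hg : PwC1 g) : PwC1 (f + g) := by
  obtain ⟨hf0, s, hs, K, hK⟩ := hf
  obtain ⟨hg0, t, ht, L, hL⟩ := hg
  refine ⟨hf0.add hg0, s ∪ t, hs.union ht, K + L, fun x hx => ?_⟩
  simp only [mem_sdiff, mem_union, not_or] at hx
  obtain ⟨h1, h2⟩ := hK x ⟨hx.1, hx.2.1⟩
  obtain ⟨h3, h4⟩ := hL x ⟨hx.1, hx.2.2⟩
  refine ⟨h1.add h3, ?_⟩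
  rw [deriv_add h1 h3]
  exact (abs_add_le _ _).trans (add_le_add h2 h4)

lemma PwC1.mul {f g : ℝ → ℝ} (hf : PwC1 f) (hg : PwC1 g) : PwC1 (f * g) := by
  obtain ⟨A, hA⟩ := isCompact_Icc.exists_bound_of_continuousOn hf.1
  obtain ⟨B, hB⟩ := isCompact_Icc.exists_bound_of_continuousOn hg.1
  obtain ⟨hf0, s, hs, K, hK⟩ := hf
  obtain ⟨hg0, t, ht, L, hL⟩ := hg
  refine ⟨hf0.mul hg0, s ∪ t, hs.union ht, K * B + A * L, fun x hx => ?_⟩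
  simp only [mem_sdiff, mem_union, not_or] at hx
  obtain ⟨h1, h2⟩ := hK x ⟨hx.1, hx.2.1⟩
  obtain ⟨h3, h4⟩ := hL x ⟨hx.1, hx.2.2⟩
  have h5 := hA x (Ioo_subset_Icc_self hx.1)
  have h6 := hB x (Ioo_subset_Icc_self hx.1)
  rw [Real.norm_eq_abs] at h5 h6
  refine ⟨h1.mul h3, ?_⟩
  rw [deriv_mul h1 h3]
  refine (abs_add_le _ _).trans (add_le_add ?_ ?_) <;> rw [abs_mul]
  · exact mul_le_mul h2 h6 (abs_nonneg _) ((abs_nonneg _).trans h2)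
  · exact mul_le_mul h5 h4 (abs_nonneg _) ((abs_nonneg _).trans h5)

lemma PwC1.const (c : ℝ) : PwC1 (fun _ => c) :=
  ⟨continuousOn_const, ∅, countable_empty, 0, fun x _ => by simp⟩

lemma PwC1.one : PwC1 1 := PwC1.const 1

lemma PwC1.smul {f : ℝ → ℝ} (c : ℝ) (hf : PwC1 f) : PwC1 (c • f) := (PwC1.const c).mul hf

lemma PwC1.sub {f g : ℝ → ℝ} (hf : PwC1 f) (hg : PwC1 g) : PwC1 (f - g) := by
  have := hf.add (hg.smul (-1))
  simpa [sub_eq_add_neg] using this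

/-- A differentiable function on `[0,1]` with bounded derivative. -/
lemma PwC1.of_hasDerivWithinAt {f f' : ℝ → ℝ} {K : ℝ}
    (h : ∀ x ∈ Icc (0 : ℝ) 1, HasDerivWithinAt f (f' x) (Icc 0 1) x)
    (hK : ∀ x ∈ Icc (0 : ℝ) 1, |f' x| ≤ K) : PwC1 f := by
  refine ⟨fun x hx => (h x hx).continuousWithinAt, ∅, countable_empty, K, fun x hx => ?_⟩
  have h1 := (h x (Ioo_subset_Icc_self hx.1)).hasDerivAt (Icc_mem_nhds hx.1.1 hx.1.2)
  exact ⟨h1.differentiableAt, h1.deriv ▸ hK x (Ioo_subset_Icc_self hx.1)⟩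

lemma deriv_ae_eq_of_hasDerivWithinAt {f f' : ℝ → ℝ}
    (h : ∀ x ∈ Icc (0 : ℝ) 1, HasDerivWithinAt f (f' x) (Icc 0 1) x) :
    deriv f =ᵐ[unitVol] f' :=
  ae_of_Ioo fun x hx =>
    ((h x (Ioo_subset_Icc_self hx)).hasDerivAt (Icc_mem_nhds hx.1 hx.2)).deriv

lemma PwC1.deriv_add_ae {f g : ℝ → ℝ} (hf : PwC1 f) (hg : PwC1 g) :
    deriv (f + g) =ᵐ[unitVol] deriv f + deriv g := by
  filter_upwards [hf.ae_differentiableAt, hg.ae_differentiableAt] with x h1 h2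
  exact deriv_add h1 h2

lemma PwC1.deriv_sub_ae {f g : ℝ → ℝ} (hf : PwC1 f) (hg : PwC1 g) :
    deriv (f - g) =ᵐ[unitVol] deriv f - deriv g := by
  filter_upwards [hf.ae_differentiableAt, hg.ae_differentiableAt] with x h1 h2
  exact deriv_sub h1 h2

lemma PwC1.deriv_mul_ae {f g : ℝ → ℝ} (hf : PwC1 f) (hg : PwC1 g) :
    deriv (f * g) =ᵐ[unitVol] deriv f * g + f * deriv g := by
  filter_upwards [hf.ae_differentiableAt, hg.ae_differentiableAt] with x h1 h2
  exact deriv_mul h1 h2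

lemma PwC1.integral_deriv {f : ℝ → ℝ} (hf : PwC1 f) : ∫ x, deriv f x ∂unitVol = f 1 - f 0 := by
  have hi := hf.essBdd_deriv.integrable
  obtain ⟨hf0, s, hs, K, hK⟩ := hf
  rw [← intervalIntegral.integral_of_le zero_le_one]
  refine integral_eq_of_hasDerivAt_off_countable_of_le f (deriv f) zero_le_one hs hf0
    (fun x hx => (hK x hx).1.hasDerivAt) ?_
  rw [intervalIntegrable_iff_integrableOn_Ioc_of_le zero_le_one]
  exact hi

/-- Integration by parts. -/
lemma PwC1.ip_deriv_left {f g : ℝ → ℝ} (hf : PwC1 f) (hg : PwC1 g) :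
    ip (deriv f) g = f 1 * g 1 - f 0 * g 0 - ip f (deriv g) := by
  have h := (hf.mul hg).integral_deriv
  rw [integral_congr_ae (hf.deriv_mul_ae hg)] at h
  rw [integral_add' (hf.essBdd_deriv.mul hg.essBdd).integrable
    (hf.essBdd.mul hg.essBdd_deriv).integrable] at h
  rw [ip_eq_integral, ip_eq_integral]
  simp only [Pi.mul_apply] at h
  linarith

/-- Integration by parts against a function which vanishes at both end points. -/
lemma PwC1.ip_deriv_right_of_zero {f g : ℝ → ℝ} (hf : PwC1 f) (hg : PwC1 g) (h0 : f 0 = 0)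
    (h1 : f 1 = 0) : ip f (deriv g) = -ip (deriv f) g := by
  rw [hf.ip_deriv_left hg, h0, h1]
  ring

/-! ### The form `a` and its norm -/

lemma a_add_left {v v' w : ℝ → ℝ} (hv : PwC1 v) (hv' : PwC1 v') (hw : PwC1 w) :
    a (v + v') w = a v w + a v' w := by
  simp only [a]
  rw [ip_add_left hv.essBdd hv'.essBdd hw.essBdd, ip_congr (hv.deriv_add_ae hv') ae_eq_rfl,
    ip_add_left hv.essBdd_deriv hv'.essBdd_deriv hw.essBdd_deriv]
  ring

lemma a_self_nonneg (v : ℝ → ℝ) : 0 ≤ a v v :=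
  add_nonneg (ip_self_nonneg _) (mul_nonneg (by norm_num) (ip_self_nonneg _))

lemma normH1_nonneg (f : ℝ → ℝ) : 0 ≤ normH1 f := Real.sqrt_nonneg _

lemma normH1_sq (f : ℝ → ℝ) : normH1 f ^ 2 = a f f := Real.sq_sqrt (a_self_nonneg f)

lemma normH1_sq' (f : ℝ → ℝ) :
    normH1 f ^ 2 = normL2 f ^ 2 + 1 / 3 * normL2 (deriv f) ^ 2 := by
  rw [normH1_sq, a, normL2_sq, normL2_sq]

lemma normL2_le_normH1 (f : ℝ → ℝ) : normL2 f ≤ normH1 f := by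
  refine Real.sqrt_le_sqrt ?_
  have := ip_self_nonneg (deriv f)
  simp only [a]
  linarith

lemma normL2_deriv_le_normH1 (f : ℝ → ℝ) : normL2 (deriv f) ≤ 2 * normH1 f := by
  refine abs_le_of_sq_le_sq' ?_ (mul_nonneg zero_le_two (normH1_nonneg f)) |>.2
  nlinarith [normH1_sq' f, sq_nonneg (normL2 f), sq_nonneg (normL2 (deriv f))]

lemma normH1_le (f : ℝ → ℝ) : normH1 f ≤ normL2 f + normL2 (deriv f) := by
  have h1 := normL2_nonneg f
  have h2 := normL2_nonneg (deriv f)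
  refine abs_le_of_sq_le_sq' ?_ (add_nonneg h1 h2) |>.2
  nlinarith [normH1_sq' f, mul_nonneg h1 h2, sq_nonneg (normL2 (deriv f))]

lemma normH1_add_le {f g : ℝ → ℝ} (hf : PwC1 f) (hg : PwC1 g) :
    normH1 (f + g) ≤ normH1 f + normH1 g := by
  have h0 : normH1 (f + g) ^ 2 ≤ (normL2 f + normL2 g) ^ 2
      + 1 / 3 * (normL2 (deriv f) + normL2 (deriv g)) ^ 2 := by
    rw [normH1_sq', normL2_congr (hf.deriv_add_ae hg)]
    have h1 := normL2_add_le hf.essBdd hg.essBdd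
    have h2 := normL2_add_le hf.essBdd_deriv hg.essBdd_deriv
    have := normL2_nonneg (f + g)
    have := normL2_nonneg (deriv f + deriv g)
    gcongr
  have h1 : normL2 f * normL2 g + 1 / 3 * (normL2 (deriv f) * normL2 (deriv g))
      ≤ normH1 f * normH1 g := by
    have hf1 := normH1_nonneg f
    have hg1 := normH1_nonneg g
    refine abs_le_of_sq_le_sq' ?_ (mul_nonneg hf1 hg1) |>.2
    rw [mul_pow, normH1_sq', normH1_sq']
    nlinarith [sq_nonneg (normL2 f * normL2 (deriv g) - normL2 g * normL2 (deriv f))]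
  refine abs_le_of_sq_le_sq' ?_ (add_nonneg (normH1_nonneg f) (normH1_nonneg g)) |>.2
  nlinarith [normH1_sq' f, normH1_sq' g]

/-! ### Piecewise linear functions on the uniform mesh -/

lemma cell_subset {N j : ℕ} (hj : j < N) :
    Icc ((j : ℝ) / N) (((j : ℝ) + 1) / N) ⊆ Icc 0 1 := by
  have hN : (0 : ℝ) < N := by exact_mod_cast (Nat.zero_le j).trans_lt hj
  refine Icc_subset_Icc (by positivity) ?_
  rw [div_le_one hN]
  exact_mod_cast hj

lemma cell_lt {N : ℕ} (hN : 0 < N) (j : ℕ) : (j : ℝ) / N < ((j : ℝ) + 1) / N := by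
  have : (0 : ℝ) < N := by exact_mod_cast hN
  gcongr
  linarith

lemma exists_open_cell {N : ℕ} (hN : 0 < N) {x : ℝ} (hx : x ∈ Ioo (0 : ℝ) 1)
    (hn : x ∉ range fun i : ℕ => (i : ℝ) / N) :
    ∃ j < N, x ∈ Ioo ((j : ℝ) / N) (((j : ℝ) + 1) / N) := by
  have hN' : (0 : ℝ) < N := by exact_mod_cast hN
  have h0 : 0 ≤ x * N := mul_nonneg hx.1.le hN'.le
  refine ⟨⌊x * N⌋₊, ?_, ?_, ?_⟩
  · rw [Nat.floor_lt h0]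
    nlinarith [hx.2]
  · refine lt_of_le_of_ne ?_ fun h => hn ⟨_, h⟩
    rw [div_le_iff₀ hN']
    exact Nat.floor_le h0
  · rw [lt_div_iff₀ hN']
    exact Nat.lt_floor_add_one _

/-- Almost every point of the unit interval is interior to a cell. -/
lemma ae_of_cells {N : ℕ} (hN : 0 < N) {p : ℝ → Prop}
    (h : ∀ j < N, ∀ x ∈ Ioo ((j : ℝ) / N) (((j : ℝ) + 1) / N), p x) : ∀ᵐ x ∂unitVol, p x := by
  refine ae_of_off_countable (countable_range fun i : ℕ => (i : ℝ) / N) fun x hx => ?_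
  obtain ⟨j, hj, hxj⟩ := exists_open_cell hN hx.1 hx.2
  exact h j hj x hxj

lemma exists_cell {N : ℕ} (hN : 0 < N) {x : ℝ} (hx : x ∈ Icc (0 : ℝ) 1) :
    ∃ j < N, x ∈ Icc ((j : ℝ) / N) (((j : ℝ) + 1) / N) := by
  have hN' : (0 : ℝ) < N := by exact_mod_cast hN
  rcases hx.2.lt_or_eq with h1 | h1
  · have h0 : 0 ≤ x * N := mul_nonneg hx.1 hN'.le
    refine ⟨⌊x * N⌋₊, ?_, ?_, ?_⟩
    · rw [Nat.floor_lt h0]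
      nlinarith
    · rw [div_le_iff₀ hN']
      exact Nat.floor_le h0
    · rw [le_div_iff₀ hN']
      exact (Nat.lt_floor_add_one _).le
  · have hc : (((N - 1 : ℕ) : ℝ)) = N - 1 := by
      rw [Nat.cast_sub hN, Nat.cast_one]
    refine ⟨N - 1, Nat.sub_lt hN one_pos, ?_⟩
    rw [hc, h1]
    constructor
    · rw [div_le_one hN']
      linarith
    · rw [le_div_iff₀ hN']
      linarith

/-- The slope of a piecewise linear function on the cell `[j/N, (j+1)/N]`. -/
def slopeOn (N : ℕ) (φ : ℝ → ℝ) (j : ℕ) : ℝ := N * (φ (((j : ℝ) + 1) / N) - φ ((j : ℝ) / N))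

lemma S.eq_affine {N : ℕ} {φ : ℝ → ℝ} (hφ : φ ∈ S N) {j : ℕ} (hj : j < N) {x : ℝ}
    (hx : x ∈ Icc ((j : ℝ) / N) (((j : ℝ) + 1) / N)) :
    φ x = φ ((j : ℝ) / N) + slopeOn N φ j * (x - (j : ℝ) / N) := by
  have hN : 0 < N := (Nat.zero_le j).trans_lt hj
  have hN' : (N : ℝ) ≠ 0 := by exact_mod_cast hN.ne'
  obtain ⟨c, d, h⟩ := hφ.2 j hj
  have hlt := (cell_lt hN j).le
  rw [slopeOn, h x hx, h _ (left_mem_Icc.2 hlt), h _ (right_mem_Icc.2 hlt)]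
  field_simp
  ring

lemma S.hasDerivAt {N : ℕ} {φ : ℝ → ℝ} (hφ : φ ∈ S N) {j : ℕ} (hj : j < N) {x : ℝ}
    (hx : x ∈ Ioo ((j : ℝ) / N) (((j : ℝ) + 1) / N)) : HasDerivAt φ (slopeOn N φ j) x := by
  have h1 : HasDerivAt (fun y => φ ((j : ℝ) / N) + slopeOn N φ j * (y - (j : ℝ) / N))
      (slopeOn N φ j) x := by
    simpa using (((hasDerivAt_id x).sub_const ((j : ℝ) / N)).const_mul
      (slopeOn N φ j)).const_add (φ ((j : ℝ) / N))
  refine h1.congr_of_eventuallyEq ?_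
  filter_upwards [Ioo_mem_nhds hx.1 hx.2] with y hy
  exact S.eq_affine hφ hj (Ioo_subset_Icc_self hy)

lemma S.pwC1 {N : ℕ} (hN : 0 < N) {φ : ℝ → ℝ} (hφ : φ ∈ S N) : PwC1 φ := by
  refine ⟨hφ.1, range fun i : ℕ => (i : ℝ) / N, countable_range _,
    ∑ j ∈ Finset.range N, |slopeOn N φ j|, fun x hx => ?_⟩
  obtain ⟨j, hj, hxj⟩ := exists_open_cell hN hx.1 hx.2
  have h := S.hasDerivAt hφ hj hxj
  refine ⟨h.differentiableAt, ?_⟩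
  rw [h.deriv]
  exact Finset.single_le_sum (f := fun j => |slopeOn N φ j|) (fun i _ => abs_nonneg _)
    (Finset.mem_range.2 hj)

lemma S.add {N : ℕ} {φ ψ : ℝ → ℝ} (hφ : φ ∈ S N) (hψ : ψ ∈ S N) : φ + ψ ∈ S N := by
  refine ⟨hφ.1.add hψ.1, fun j hj => ?_⟩
  obtain ⟨c, d, h⟩ := hφ.2 j hj
  obtain ⟨c', d', h'⟩ := hψ.2 j hj
  refine ⟨c + c', d + d', fun x hx => ?_⟩
  rw [Pi.add_apply, h x hx, h' x hx]
  ring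

lemma S.smul {N : ℕ} {φ : ℝ → ℝ} (r : ℝ) (hφ : φ ∈ S N) : r • φ ∈ S N := by
  refine ⟨hφ.1.const_smul r, fun j hj => ?_⟩
  obtain ⟨c, d, h⟩ := hφ.2 j hj
  refine ⟨r * c, r * d, fun x hx => ?_⟩
  rw [Pi.smul_apply, h x hx, smul_eq_mul]
  ring

lemma S.sub {N : ℕ} {φ ψ : ℝ → ℝ} (hφ : φ ∈ S N) (hψ : ψ ∈ S N) : φ - ψ ∈ S N := by
  have := S.add hφ (S.smul (-1) hψ)
  simpa [sub_eq_add_neg] using this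

lemma S0.sub {N : ℕ} {φ ψ : ℝ → ℝ} (hφ : φ ∈ S0 N) (hψ : ψ ∈ S0 N) : φ - ψ ∈ S0 N :=
  ⟨S.sub hφ.1 hψ.1, by simp [hφ.2.1, hψ.2.1], by simp [hφ.2.2, hψ.2.2]⟩

/-- The nodal hat function centred at `i/N`. -/
def hat (N i : ℕ) : ℝ → ℝ := fun x => max 0 (1 - |x * N - i|)

/-- The piecewise linear interpolant of `v` at the nodes `i/N`, `0 ≤ i ≤ N`. -/
def interp (N : ℕ) (v : ℝ → ℝ) : ℝ → ℝ :=
  ∑ i ∈ Finset.range (N + 1), v ((i : ℝ) / N) • hat N i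

lemma hat_mem (N i : ℕ) : hat N i ∈ S N := by
  refine ⟨Continuous.continuousOn (by unfold hat; fun_prop), fun j hj => ?_⟩
  have hN : (0 : ℝ) < N := by exact_mod_cast (Nat.zero_le j).trans_lt hj
  have key : ∀ x ∈ Icc ((j : ℝ) / N) (((j : ℝ) + 1) / N), (j : ℝ) ≤ x * N ∧ x * N ≤ j + 1 :=
    fun x hx => ⟨(div_le_iff₀ hN).1 hx.1, (le_div_iff₀ hN).1 hx.2⟩
  rcases lt_trichotomy i j with hij | rfl | hij
  · refine ⟨0, 0, fun x hx => ?_⟩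
    have h1 : (i : ℝ) + 1 ≤ j := by exact_mod_cast hij
    have := key x hx
    rw [hat, abs_of_nonneg (by linarith), max_eq_left (by linarith)]
    ring
  · refine ⟨-N, i + 1, fun x hx => ?_⟩
    have := key x hx
    rw [hat, abs_of_nonneg (by linarith), max_eq_right (by linarith)]
    ring
  · have h1 : (j : ℝ) + 1 ≤ i := by exact_mod_cast hij
    rcases h1.eq_or_lt with h2 | h2
    · refine ⟨N, 1 - i, fun x hx => ?_⟩
      have := key x hx
      rw [hat, abs_of_nonpos (by linarith), max_eq_right (by linarith)]
      ring
    · have h3 : (j : ℝ) + 2 ≤ i := by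
        have : j + 1 < i := by exact_mod_cast h2
        exact_mod_cast this
      refine ⟨0, 0, fun x hx => ?_⟩
      have := key x hx
      rw [hat, abs_of_nonpos (by linarith), max_eq_left (by linarith)]
      ring

lemma hat_node {N : ℕ} (hN : 0 < N) (i j : ℕ) :
    hat N i ((j : ℝ) / N) = if i = j then 1 else 0 := by
  have hN' : (N : ℝ) ≠ 0 := by exact_mod_cast hN.ne'
  rw [hat, div_mul_cancel₀ _ hN']
  split_ifs with h
  · simp [h]
  · refine max_eq_left ?_
    have : (1 : ℝ) ≤ |(j : ℝ) - i| := by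
      have h1 : (1 : ℤ) ≤ |(j : ℤ) - i| := Int.one_le_abs (by omega)
      exact_mod_cast h1
    linarith

lemma interp_mem (N : ℕ) (v : ℝ → ℝ) : interp N v ∈ S N := by
  unfold interp
  refine Finset.sum_induction _ (· ∈ S N) (fun _ _ => S.add) ?_ fun i _ => S.smul _ (hat_mem N i)
  exact ⟨continuousOn_const, fun j _ => ⟨0, 0, fun x _ => by simp⟩⟩

lemma interp_node {N : ℕ} (hN : 0 < N) (v : ℝ → ℝ) {i : ℕ} (hi : i ≤ N) :
    interp N v ((i : ℝ) / N) = v ((i : ℝ) / N) := by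
  simp only [interp, Finset.sum_apply, Pi.smul_apply, hat_node hN, smul_eq_mul, mul_ite, mul_one,
    mul_zero]
  rw [Finset.sum_ite_eq' (Finset.range (N + 1)) i fun i => v ((i : ℝ) / N)]
  simp [Nat.lt_succ_of_le hi]

lemma interp_zero {N : ℕ} (hN : 0 < N) (v : ℝ → ℝ) : interp N v 0 = v 0 := by
  simpa using interp_node hN v (Nat.zero_le N)

lemma interp_one {N : ℕ} (hN : 0 < N) (v : ℝ → ℝ) : interp N v 1 = v 1 := by
  have hN' : (N : ℝ) ≠ 0 := by exact_mod_cast hN.ne'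
  simpa [div_self hN'] using interp_node hN v le_rfl

lemma interp_sub (N : ℕ) (v w : ℝ → ℝ) : interp N (v - w) = interp N v - interp N w := by
  simp only [interp, Pi.sub_apply, sub_smul, Finset.sum_sub_distrib]

/-- A piecewise linear function is determined by its nodal values. -/
lemma S.eqOn_interp {N : ℕ} (hN : 0 < N) {φ v : ℝ → ℝ} (hφ : φ ∈ S N) (h : AgreesAtNodes N φ v) :
    EqOn φ (interp N v) (Icc 0 1) := by
  intro x hx
  obtain ⟨j, hj, hxj⟩ := exists_cell hN hx
  have h1 : φ ((j : ℝ) / N) = interp N v ((j : ℝ) / N) := by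
    rw [interp_node hN v hj.le, h j hj.le]
  have h2 : φ (((j : ℝ) + 1) / N) = interp N v (((j : ℝ) + 1) / N) := by
    have := interp_node hN v (Nat.succ_le_of_lt hj)
    have h' := h (j + 1) (Nat.succ_le_of_lt hj)
    push_cast at this h'
    rw [this, h']
  rw [S.eq_affine hφ hj hxj, S.eq_affine (interp_mem N v) hj hxj, slopeOn, slopeOn, h1, h2]

/-! ### Cellwise integration and inverse inequalities -/

lemma EssBdd.intervalIntegrable {f : ℝ → ℝ} (hf : EssBdd f) {c d : ℝ} (hcd : c ≤ d)
    (h : Icc c d ⊆ Icc 0 1) : IntervalIntegrable f volume c d := by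
  rw [intervalIntegrable_iff_integrableOn_Ioc_of_le hcd]
  refine IntegrableOn.mono_set hf.integrable fun x hx => ?_
  have h0 := (h (left_mem_Icc.2 hcd)).1
  exact ⟨h0.trans_lt hx.1, (h (Ioc_subset_Icc_self hx)).2⟩

lemma PwC1.intervalIntegral_deriv {f : ℝ → ℝ} (hf : PwC1 f) {c d : ℝ} (hcd : c ≤ d)
    (h : Icc c d ⊆ Icc 0 1) : ∫ x in c..d, deriv f x = f d - f c := by
  have hi := hf.essBdd_deriv.intervalIntegrable hcd h
  obtain ⟨hf0, s, hs, K, hK⟩ := hf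
  have h0 := (h (left_mem_Icc.2 hcd)).1
  have h1 := (h (right_mem_Icc.2 hcd)).2
  exact integral_eq_of_hasDerivAt_off_countable_of_le f (deriv f) hcd hs (hf0.mono h)
    (fun x hx => (hK x ⟨⟨h0.trans_lt hx.1.1, hx.1.2.trans_le h1⟩, hx.2⟩).1.hasDerivAt) hi

lemma ip_eq_sum_cells {N : ℕ} (hN : 0 < N) {f g : ℝ → ℝ} (hf : EssBdd f) (hg : EssBdd g) :
    ip f g = ∑ j ∈ Finset.range N, ∫ x in ((j : ℝ) / N)..(((j : ℝ) + 1) / N), f x * g x := by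
  have hN' : (N : ℝ) ≠ 0 := by exact_mod_cast hN.ne'
  have h := intervalIntegral.sum_integral_adjacent_intervals (μ := volume)
    (f := fun x => f x * g x) (a := fun j : ℕ => (j : ℝ) / N) (n := N) fun j hj => by
      push_cast
      exact (hf.mul hg).intervalIntegrable (cell_lt hN j).le (cell_subset hj)
  rw [ip]
  simp only [Nat.cast_zero, zero_div, div_self hN'] at h
  rw [← h]
  push_cast
  rfl

/-- Testing with the derivative of a piecewise linear function only sees cell averages. -/
lemma ip_deriv_S {N : ℕ} (hN : 0 < N) {f φ : ℝ → ℝ} (hf : EssBdd f) (hφ : φ ∈ S N) :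
    ip f (deriv φ) = ∑ j ∈ Finset.range N,
      slopeOn N φ j * ∫ x in ((j : ℝ) / N)..(((j : ℝ) + 1) / N), f x := by
  rw [ip_eq_sum_cells hN hf (S.pwC1 hN hφ).essBdd_deriv]
  refine Finset.sum_congr rfl fun j hj => ?_
  rw [← intervalIntegral.integral_const_mul]
  refine intervalIntegral.integral_congr_Ioo_of_le (cell_lt hN j).le fun x hx => ?_
  rw [(S.hasDerivAt hφ (Finset.mem_range.1 hj) hx).deriv, mul_comm]

lemma cell_integral_le {N : ℕ} (hN : 0 < N) {f : ℝ → ℝ} (hf : EssBdd f) {j : ℕ} (hj : j < N) :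
    ∫ x in ((j : ℝ) / N)..(((j : ℝ) + 1) / N), f x * f x ≤ ip f f := by
  rw [ip_eq_sum_cells hN hf hf]
  exact Finset.single_le_sum
    (f := fun j : ℕ => ∫ x in ((j : ℝ) / N)..(((j : ℝ) + 1) / N), f x * f x)
    (fun i _ => intervalIntegral.integral_nonneg (cell_lt hN i).le fun x _ => mul_self_nonneg _)
    (Finset.mem_range.2 hj)

lemma integral_affine_sq (A m c h : ℝ) :
    ∫ x in c..(c + h), (A + m * (x - c)) * (A + m * (x - c))
      = h * (A ^ 2 + A * (m * h) + (m * h) ^ 2 / 3) := by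
  have h1 : ∀ x ∈ uIcc c (c + h), HasDerivAt
      (fun x => A ^ 2 * (x - c) + A * m * (x - c) ^ 2 + m ^ 2 / 3 * (x - c) ^ 3)
      ((A + m * (x - c)) * (A + m * (x - c))) x := fun x _ => by
    have h0 := (hasDerivAt_id x).sub_const c
    have := ((h0.const_mul (A ^ 2)).add ((h0.pow 2).const_mul (A * m))).add
      ((h0.pow 3).const_mul (m ^ 2 / 3))
    refine this.congr_deriv ?_
    simp
    ring
  rw [intervalIntegral.integral_eq_sub_of_hasDerivAt h1
    (Continuous.intervalIntegrable (by fun_prop) _ _)]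
  ring

lemma S.cell_integral_sq {N : ℕ} {φ : ℝ → ℝ} (hφ : φ ∈ S N) {j : ℕ} (hj : j < N) :
    ∫ x in ((j : ℝ) / N)..(((j : ℝ) + 1) / N), φ x * φ x
      = 1 / N * (φ ((j : ℝ) / N) ^ 2 + φ ((j : ℝ) / N) * (slopeOn N φ j * (1 / N))
        + (slopeOn N φ j * (1 / N)) ^ 2 / 3) := by
  have hN : 0 < N := (Nat.zero_le j).trans_lt hj
  rw [← integral_affine_sq (φ ((j : ℝ) / N)) (slopeOn N φ j) ((j : ℝ) / N) (1 / N), ← add_div]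
  refine intervalIntegral.integral_congr fun x hx => ?_
  rw [uIcc_of_le (cell_lt hN j).le] at hx
  rw [S.eq_affine hφ hj hx]

/-- The inverse inequality between the maximum norm and the `L²` norm. -/
lemma S.abs_le {N : ℕ} (hN : 0 < N) {φ : ℝ → ℝ} (hφ : φ ∈ S N) {x : ℝ} (hx : x ∈ Icc (0 : ℝ) 1) :
    |φ x| ≤ 2 * √N * normL2 φ := by
  have hN' : (0 : ℝ) < N := by exact_mod_cast hN
  obtain ⟨j, hj, hxj⟩ := exists_cell hN hx
  have h1 := (S.cell_integral_sq hφ hj).symm.trans_le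
    (cell_integral_le hN (S.pwC1 hN hφ).essBdd hj)
  have h3 : 0 ≤ x - (j : ℝ) / N := by linarith [hxj.1]
  have h4 : x - (j : ℝ) / N ≤ 1 / N := by have := hxj.2; rw [add_div] at this; linarith
  refine abs_le_of_sq_le_sq ?_ (by have := normL2_nonneg φ; positivity)
  rw [mul_pow, mul_pow, Real.sq_sqrt hN'.le, normL2_sq, S.eq_affine hφ hj hxj]
  set A := φ ((j : ℝ) / N)
  set m := slopeOn N φ j
  set y := x - (j : ℝ) / N
  set d := m * (1 / N)
  -- `A + m y` lies between the end point values `A` and `A + d`, so its square is at most the larger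
  -- of theirs, and each is at most `4 (A² + A d + d² / 3)`.
  have h5 : (A + m * y) ^ 2 ≤ 4 * (A ^ 2 + A * d + d ^ 2 / 3) := by
    have e : m * y = (N * y) * d := by
      simp only [d]
      field_simp
    have f0 : 0 ≤ N * y := by positivity
    have f1 : N * y ≤ 1 := by
      have := mul_le_mul_of_nonneg_left h4 hN'.le
      rwa [mul_one_div_cancel hN'.ne'] at this
    rw [e]
    generalize N * y = s at f0 f1
    have g1 : (A + s * d) ^ 2 ≤ (1 - s) * A ^ 2 + s * (A + d) ^ 2 := by
      nlinarith [mul_nonneg (mul_nonneg f0 (sub_nonneg.2 f1)) (sq_nonneg d)]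
    nlinarith [mul_nonneg (sub_nonneg.2 f1) (sq_nonneg (3 * A + 2 * d)),
      mul_nonneg f0 (sq_nonneg (3 * A + d))]
  have h6 : A ^ 2 + A * d + d ^ 2 / 3 ≤ N * ip φ φ := by
    rw [one_div, inv_mul_le_iff₀ hN'] at h1
    exact h1
  nlinarith

/-- The inverse inequality for the derivative. -/
lemma S.normL2_deriv_le {N : ℕ} (hN : 0 < N) {φ : ℝ → ℝ} (hφ : φ ∈ S N) :
    normL2 (deriv φ) ≤ 4 * N * normL2 φ := by
  have hN' : (0 : ℝ) < N := by exact_mod_cast hN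
  have hp := S.pwC1 hN hφ
  refine abs_le_of_sq_le_sq' ?_ (by have := normL2_nonneg φ; positivity) |>.2
  rw [mul_pow, normL2_sq, normL2_sq, ip_eq_sum_cells hN hp.essBdd hp.essBdd,
    ip_eq_sum_cells hN hp.essBdd_deriv hp.essBdd_deriv, Finset.mul_sum]
  refine Finset.sum_le_sum fun j hj => ?_
  have hj := Finset.mem_range.1 hj
  have e : ∫ x in ((j : ℝ) / N)..(((j : ℝ) + 1) / N), deriv φ x * deriv φ x
      = 1 / N * slopeOn N φ j ^ 2 := by
    have : ∫ x in ((j : ℝ) / N)..(((j : ℝ) + 1) / N), deriv φ x * deriv φ x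
        = ∫ _ in ((j : ℝ) / N)..(((j : ℝ) + 1) / N), slopeOn N φ j ^ 2 := by
      refine intervalIntegral.integral_congr_Ioo_of_le (cell_lt hN j).le fun x hx => ?_
      rw [(S.hasDerivAt hφ hj hx).deriv]
      ring
    rw [this, intervalIntegral.integral_const, smul_eq_mul]
    ring
  rw [e, S.cell_integral_sq hφ hj]
  set A := φ ((j : ℝ) / N)
  set m := slopeOn N φ j
  have h2 : m = N * (m * (1 / N)) := by field_simp
  set d := m * (1 / N)
  rw [h2]
  have h3 : d ^ 2 ≤ 16 * (A ^ 2 + A * d + d ^ 2 / 3) := by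
    nlinarith [sq_nonneg (2 * A + d), sq_nonneg d]
  have h4 : 0 ≤ 1 / (N : ℝ) * N ^ 2 := by positivity
  nlinarith [mul_le_mul_of_nonneg_left h3 h4]

/-! ### Interpolation error -/

/-- If `|f''| ≤ K` on an interval of length `h`, the linear interpolant at the end points, of slope
`m`, has error at most `K h²`, and `m` differs from `f'` by at most `K h`. -/
lemma linear_interp_error {f f₁ f₂ L : ℝ → ℝ} {c h K m : ℝ} (hh : 0 < h)
    (h0 : ∀ x ∈ Icc c (c + h), HasDerivWithinAt f (f₁ x) (Icc c (c + h)) x)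
    (h1 : ∀ x ∈ Icc c (c + h), HasDerivWithinAt f₁ (f₂ x) (Icc c (c + h)) x)
    (h2 : ∀ x ∈ Icc c (c + h), |f₂ x| ≤ K)
    (hL : ∀ x ∈ Icc c (c + h), L x = f c + m * (x - c)) (hm : m * h = f (c + h) - f c)
    {x : ℝ} (hx : x ∈ Icc c (c + h)) : |L x - f x| ≤ K * h ^ 2 ∧ |m - f₁ x| ≤ K * h := by
  have hK : 0 ≤ K := (abs_nonneg _).trans (h2 x hx)
  obtain ⟨ξ, hξ, hξm⟩ := exists_hasDerivAt_eq_slope f f₁ (by linarith : c < c + h)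
    (fun y hy => (h0 y hy).continuousWithinAt)
    (fun y hy => (h0 y (Ioo_subset_Icc_self hy)).hasDerivAt (Icc_mem_nhds hy.1 hy.2))
  have hmξ : m = f₁ ξ := by
    rw [hξm, ← hm, add_sub_cancel_left, mul_div_cancel_right₀ _ hh.ne']
  have key : ∀ y ∈ Icc c (c + h), |m - f₁ y| ≤ K * h := fun y hy => by
    have := (convex_Icc c (c + h)).norm_image_sub_le_of_norm_hasDerivWithin_le h1 h2 hy
      (Ioo_subset_Icc_self hξ)
    rw [hmξ]
    refine this.trans (mul_le_mul_of_nonneg_left ?_ hK)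
    rw [Real.norm_eq_abs, abs_le]
    constructor <;> linarith [hξ.1, hξ.2, hy.1, hy.2]
  refine ⟨?_, key x hx⟩
  have hc : c ∈ Icc c (c + h) := left_mem_Icc.2 (by linarith)
  have hd : ∀ y ∈ Icc c (c + h),
      HasDerivWithinAt (fun y => m * (y - c) - f y) (m - f₁ y) (Icc c (c + h)) y := fun y hy => by
    have := (((hasDerivWithinAt_id y (Icc c (c + h))).sub_const c).const_mul m).sub (h0 y hy)
    rw [mul_one] at this
    exact this
  have h3 := (convex_Icc c (c + h)).norm_image_sub_le_of_norm_hasDerivWithin_le hd key hc hx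
  rw [hL x hx]
  have e : f c + m * (x - c) - f x = (m * (x - c) - f x) - (m * (c - c) - f c) := by ring
  rw [e, ← Real.norm_eq_abs]
  refine h3.trans ?_
  rw [Real.norm_eq_abs, abs_of_nonneg (by linarith [hx.1]), pow_two, ← mul_assoc]
  exact mul_le_mul_of_nonneg_left (by linarith [hx.2]) (by positivity)

/-- `f₁` and `f₂` are the first two derivatives of `f` on `[0,1]`. -/
structure HasDerivs (f f₁ f₂ : ℝ → ℝ) : Prop where
  d0 : ∀ x ∈ Icc (0 : ℝ) 1, HasDerivWithinAt f (f₁ x) (Icc 0 1) x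
  d1 : ∀ x ∈ Icc (0 : ℝ) 1, HasDerivWithinAt f₁ (f₂ x) (Icc 0 1) x

/-- `f₁`, `f₂`, `f₃` are the first three derivatives of `f` on `[0,1]`, and `K` bounds `|f|` and the
absolute values of all three. -/
structure HasBddDerivs (K : ℝ) (f f₁ f₂ f₃ : ℝ → ℝ) : Prop extends HasDerivs f f₁ f₂ where
  d2 : ∀ x ∈ Icc (0 : ℝ) 1, HasDerivWithinAt f₂ (f₃ x) (Icc 0 1) x
  b0 : ∀ x ∈ Icc (0 : ℝ) 1, |f x| ≤ K
  b1 : ∀ x ∈ Icc (0 : ℝ) 1, |f₁ x| ≤ K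
  b2 : ∀ x ∈ Icc (0 : ℝ) 1, |f₂ x| ≤ K
  b3 : ∀ x ∈ Icc (0 : ℝ) 1, |f₃ x| ≤ K

lemma HasDerivs.sub {f f₁ f₂ g g₁ g₂ : ℝ → ℝ} (hf : HasDerivs f f₁ f₂) (hg : HasDerivs g g₁ g₂) :
    HasDerivs (f - g) (f₁ - g₁) (f₂ - g₂) :=
  ⟨fun x hx => (hf.d0 x hx).sub (hg.d0 x hx), fun x hx => (hf.d1 x hx).sub (hg.d1 x hx)⟩

lemma slopeOn_interp {N : ℕ} (v : ℝ → ℝ) {j : ℕ} (hj : j < N) :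
    slopeOn N (interp N v) j = slopeOn N v j := by
  have hN : 0 < N := (Nat.zero_le j).trans_lt hj
  have h := interp_node hN v (Nat.succ_le_of_lt hj)
  push_cast at h
  rw [slopeOn, slopeOn, interp_node hN v hj.le, h]

lemma interp_eq_affine {N : ℕ} (v : ℝ → ℝ) {j : ℕ} (hj : j < N) {x : ℝ}
    (hx : x ∈ Icc ((j : ℝ) / N) (((j : ℝ) + 1) / N)) :
    interp N v x = v ((j : ℝ) / N) + slopeOn N v j * (x - (j : ℝ) / N) := by
  have hN : 0 < N := (Nat.zero_le j).trans_lt hj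
  rw [S.eq_affine (interp_mem N v) hj hx, slopeOn_interp v hj, interp_node hN v hj.le]

lemma HasDerivs.cell_error {f f₁ f₂ : ℝ → ℝ} (hf : HasDerivs f f₁ f₂) {K : ℝ}
    (hK : ∀ x ∈ Icc (0 : ℝ) 1, |f₂ x| ≤ K) {N j : ℕ} (hj : j < N) {x : ℝ}
    (hx : x ∈ Icc ((j : ℝ) / N) (((j : ℝ) + 1) / N)) :
    |interp N f x - f x| ≤ K / N ^ 2 ∧ |slopeOn N f j - f₁ x| ≤ K / N := by
  have hN : 0 < N := (Nat.zero_le j).trans_lt hj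
  have hN' : (0 : ℝ) < N := by exact_mod_cast hN
  have hsub := cell_subset hj
  rw [add_div] at hsub hx
  have h := linear_interp_error (one_div_pos.2 hN')
    (fun x hx => (hf.d0 x (hsub hx)).mono hsub) (fun x hx => (hf.d1 x (hsub hx)).mono hsub)
    (fun x hx => hK x (hsub hx)) (L := interp N f) (m := slopeOn N f j)
    (fun x hx => interp_eq_affine f hj (by rwa [add_div])) (by
      rw [slopeOn, add_div]
      field_simp) hx
  simpa [div_eq_mul_inv] using h

lemma HasDerivs.interp_error {f f₁ f₂ : ℝ → ℝ} (hf : HasDerivs f f₁ f₂) {K : ℝ}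
    (hK : ∀ x ∈ Icc (0 : ℝ) 1, |f₂ x| ≤ K) {N : ℕ} (hN : 0 < N) {x : ℝ} (hx : x ∈ Icc (0 : ℝ) 1) :
    |interp N f x - f x| ≤ K / N ^ 2 := by
  obtain ⟨j, hj, hxj⟩ := exists_cell hN hx
  exact (hf.cell_error hK hj hxj).1

lemma HasDerivs.interp_deriv_error {f f₁ f₂ : ℝ → ℝ} (hf : HasDerivs f f₁ f₂) {K : ℝ}
    (hK : ∀ x ∈ Icc (0 : ℝ) 1, |f₂ x| ≤ K) {N : ℕ} (hN : 0 < N) :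
    ∀ᵐ x ∂unitVol, |deriv (interp N f) x - f₁ x| ≤ K / N :=
  ae_of_cells hN fun j hj x hx => by
    rw [(S.hasDerivAt (interp_mem N f) hj hx).deriv, slopeOn_interp f hj]
    exact (hf.cell_error hK hj (Ioo_subset_Icc_self hx)).2

lemma HasDerivs.pwC1 {f f₁ f₂ : ℝ → ℝ} (hf : HasDerivs f f₁ f₂) : PwC1 f := by
  obtain ⟨K, hK⟩ := isCompact_Icc.exists_bound_of_continuousOn
    fun x hx => (hf.d1 x hx).continuousWithinAt
  exact PwC1.of_hasDerivWithinAt hf.d0 hK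

lemma HasDerivs.interp_bound {f f₁ f₂ : ℝ → ℝ} (hf : HasDerivs f f₁ f₂) {K : ℝ} {N : ℕ}
    (hN : 0 < N) (h0 : ∀ x ∈ Icc (0 : ℝ) 1, |f x| ≤ K) (h2 : ∀ x ∈ Icc (0 : ℝ) 1, |f₂ x| ≤ K)
    {x : ℝ} (hx : x ∈ Icc (0 : ℝ) 1) : |interp N f x| ≤ 2 * K := by
  have hN1 : (1 : ℝ) ≤ N := by exact_mod_cast hN
  have hK : 0 ≤ K := (abs_nonneg _).trans (h0 x hx)
  have i1 := (hf.interp_error h2 hN hx).trans (div_le_self hK (one_le_pow₀ hN1))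
  have := abs_add_le (interp N f x - f x) (f x)
  rw [sub_add_cancel] at this
  linarith [h0 x hx]

lemma HasDerivs.interp_deriv_bound {f f₁ f₂ : ℝ → ℝ} (hf : HasDerivs f f₁ f₂) {K : ℝ} {N : ℕ}
    (hN : 0 < N) (h1 : ∀ x ∈ Icc (0 : ℝ) 1, |f₁ x| ≤ K) (h2 : ∀ x ∈ Icc (0 : ℝ) 1, |f₂ x| ≤ K) :
    ∀ᵐ x ∂unitVol, |deriv (interp N f) x| ≤ 2 * K := by
  have hN1 : (1 : ℝ) ≤ N := by exact_mod_cast hN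
  have hK : 0 ≤ K := (abs_nonneg _).trans (h1 0 (by simp))
  filter_upwards [hf.interp_deriv_error h2 hN, ae_of_Icc h1] with x i1 i2
  have i3 := i1.trans (div_le_self hK hN1)
  have := abs_add_le (deriv (interp N f) x - f₁ x) (f₁ x)
  rw [sub_add_cancel] at this
  linarith

/-- The interpolation error is orthogonal to piecewise linear functions in the `H¹` seminorm. -/
lemma ip_deriv_interp_error {N : ℕ} (hN : 0 < N) {z χ : ℝ → ℝ} (hz : PwC1 z) (hχ : χ ∈ S N) :
    ip (deriv (interp N z - z)) (deriv χ) = 0 := by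
  have he : PwC1 (interp N z - z) := (S.pwC1 hN (interp_mem N z)).sub hz
  rw [ip_deriv_S hN he.essBdd_deriv hχ]
  refine Finset.sum_eq_zero fun j hj => ?_
  have hj := Finset.mem_range.1 hj
  have h1 := interp_node hN z (Nat.succ_le_of_lt hj)
  push_cast at h1
  rw [he.intervalIntegral_deriv (cell_lt hN j).le (cell_subset hj), Pi.sub_apply, Pi.sub_apply,
    interp_node hN z hj.le, h1]
  ring

lemma abs_sub_le_of_hasDerivWithinAt {f f₁ : ℝ → ℝ} {K : ℝ}
    (h : ∀ x ∈ Icc (0 : ℝ) 1, HasDerivWithinAt f (f₁ x) (Icc 0 1) x)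
    (hK : ∀ x ∈ Icc (0 : ℝ) 1, |f₁ x| ≤ K) {x y : ℝ} (hx : x ∈ Icc (0 : ℝ) 1)
    (hy : y ∈ Icc (0 : ℝ) 1) : |f y - f x| ≤ K * |y - x| :=
  (convex_Icc 0 1).norm_image_sub_le_of_norm_hasDerivWithin_le h hK hx hy

/-- On a uniform mesh the interpolation errors on adjacent cells cancel to third order: their
difference is the interpolation error of `f(· + h) - f`, whose second derivative is `O(h)`. -/
lemma HasBddDerivs.error_shift {f f₁ f₂ f₃ : ℝ → ℝ} {K : ℝ} (hf : HasBddDerivs K f f₁ f₂ f₃)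
    {N j : ℕ} (hj : j + 1 < N) {x : ℝ} (hx : x ∈ Icc ((j : ℝ) / N) (((j : ℝ) + 1) / N)) :
    |(interp N f (x + 1 / N) - f (x + 1 / N)) - (interp N f x - f x)| ≤ K / N ^ 3 := by
  have hj' : j < N := (Nat.lt_succ_self j).trans hj
  have hN' : (0 : ℝ) < N := by exact_mod_cast (Nat.zero_le _).trans_lt hj
  have hsub := cell_subset hj'
  have hsub1 := cell_subset hj
  push_cast at hsub1
  have e1 : ((j : ℝ) + 1) / N = (j : ℝ) / N + 1 / N := add_div _ _ _
  have e2 : ((j : ℝ) + 1 + 1) / N = (j : ℝ) / N + 1 / N + 1 / N := by rw [add_div, e1]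
  have hshift : ∀ y ∈ Icc ((j : ℝ) / N) ((j : ℝ) / N + 1 / N),
      y + 1 / N ∈ Icc (((j : ℝ) + 1) / N) (((j : ℝ) + 1 + 1) / N) := fun y hy => by
    rw [e1, e2]
    exact ⟨by linarith [hy.1], by linarith [hy.2]⟩
  have hmaps : MapsTo (fun y : ℝ => y + 1 / N) (Icc ((j : ℝ) / N) ((j : ℝ) / N + 1 / N)) (Icc 0 1) :=
    fun y hy => hsub1 (hshift y hy)
  rw [e1] at hsub hx
  have hd : ∀ {g g₁ : ℝ → ℝ}, (∀ x ∈ Icc (0 : ℝ) 1, HasDerivWithinAt g (g₁ x) (Icc 0 1) x) →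
      ∀ y ∈ Icc ((j : ℝ) / N) ((j : ℝ) / N + 1 / N),
        HasDerivWithinAt (fun y => g (y + 1 / N) - g y) (g₁ (y + 1 / N) - g₁ y)
          (Icc ((j : ℝ) / N) ((j : ℝ) / N + 1 / N)) y := fun {g g₁} hg y hy => by
    refine HasDerivWithinAt.sub ?_ ((hg y (hsub hy)).mono hsub)
    have := (hg _ (hmaps hy)).comp y ((hasDerivWithinAt_id y _).add_const (1 / (N : ℝ))) hmaps
    rw [mul_one] at this
    exact this
  have h := linear_interp_error (one_div_pos.2 hN') (hd hf.d0) (hd hf.d1) (K := K / N)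
    (fun y hy => by
      have := abs_sub_le_of_hasDerivWithinAt hf.d2 hf.b3 (hsub hy) (hmaps hy)
      simpa [div_eq_mul_inv] using this)
    (L := fun y => interp N f (y + 1 / N) - interp N f y)
    (m := slopeOn N f (j + 1) - slopeOn N f j)
    (fun y hy => by
      have a1 := interp_eq_affine f hj (x := y + 1 / N) (by push_cast; exact hshift y hy)
      have a2 := interp_eq_affine f hj' (x := y) (by rwa [e1])
      push_cast at a1
      rw [a1, a2, e1]
      ring)
    (by
      rw [slopeOn, slopeOn]
      push_cast
      rw [e1, e2]
      field_simp) hx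
  have h' := h.1
  rw [show K / (N : ℝ) ^ 3 = K / N * (1 / N) ^ 2 by field_simp]
  convert h' using 2
  ring

lemma sum_by_parts (φ b : ℕ → ℝ) (n : ℕ) :
    ∑ j ∈ Finset.range (n + 1), (φ (j + 1) - φ j) * b j
      = φ (n + 1) * b n - φ 0 * b 0
        - ∑ j ∈ Finset.range n, φ (j + 1) * (b (j + 1) - b j) := by
  induction n with
  | zero => simp; ring
  | succ n ih => rw [Finset.sum_range_succ, ih, Finset.sum_range_succ _ n]; ring

lemma abs_sum_diff_mul_le {φ b : ℕ → ℝ} {n : ℕ} {m B D : ℝ} (hφ : ∀ j ≤ n + 1, |φ j| ≤ m)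
    (hb : ∀ j ≤ n, |b j| ≤ B) (hD : ∀ j < n, |b (j + 1) - b j| ≤ D) :
    |∑ j ∈ Finset.range (n + 1), (φ (j + 1) - φ j) * b j| ≤ m * (2 * B + n * D) := by
  have hm : 0 ≤ m := (abs_nonneg _).trans (hφ 0 (Nat.zero_le _))
  have hs : |∑ j ∈ Finset.range n, φ (j + 1) * (b (j + 1) - b j)| ≤ n * (m * D) := by
    refine (Finset.abs_sum_le_sum_abs _ _).trans ?_
    refine (Finset.sum_le_card_nsmul _ _ (m * D) fun j hj => ?_).trans (by simp)
    have hj := Finset.mem_range.1 hj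
    rw [abs_mul]
    exact mul_le_mul (hφ _ (by omega)) (hD j hj) (abs_nonneg _) hm
  have h1 : |φ (n + 1) * b n| ≤ m * B := by
    rw [abs_mul]
    exact mul_le_mul (hφ _ le_rfl) (hb _ le_rfl) (abs_nonneg _) hm
  have h2 : |φ 0 * b 0| ≤ m * B := by
    rw [abs_mul]
    exact mul_le_mul (hφ _ (Nat.zero_le _)) (hb _ (Nat.zero_le _)) (abs_nonneg _) hm
  rw [sum_by_parts]
  refine (abs_sub _ _).trans ((add_le_add (abs_sub _ _) hs).trans ?_)
  nlinarith

/-- The consistency error of the interpolated flux `f g`, tested against derivatives. The pointwise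
error is `O(h²)` and, on a uniform mesh, its cell averages vary by `O(h³)` from one cell to the
next; summation by parts then leaves two boundary terms, bounded through the inverse inequality. The
latter costs the factor `√N`, so that the total is `O(h^{3/2})`. -/
lemma abs_ip_flux_error_le {f f₁ f₂ f₃ g g₁ g₂ g₃ φ : ℝ → ℝ} {K : ℝ} {N : ℕ} (hN : 0 < N)
    (hf : HasBddDerivs K f f₁ f₂ f₃) (hg : HasBddDerivs K g g₁ g₂ g₃) (hφ : φ ∈ S N) :
    |ip (interp N f * interp N g - f * g) (deriv φ)|
      ≤ 24 * K ^ 2 * (√N / N ^ 2) * normL2 φ := by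
  have hN' : (0 : ℝ) < N := by exact_mod_cast hN
  have hN1 : (1 : ℝ) ≤ N := by exact_mod_cast hN
  have hK : 0 ≤ K := (abs_nonneg _).trans (hf.b0 0 (by simp))
  have hc : ∀ {f f₁ f₂ : ℝ → ℝ}, HasDerivs f f₁ f₂ → EssBdd f := fun hf =>
    EssBdd.of_continuousOn fun x hx => (hf.d0 x hx).continuousWithinAt
  set A := interp N f * interp N g - f * g with hA
  have hAb : EssBdd A := ((S.pwC1 hN (interp_mem N f)).essBdd.mul
    (S.pwC1 hN (interp_mem N g)).essBdd).sub ((hc hf.toHasDerivs).mul (hc hg.toHasDerivs))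
  have hA1 : ∀ x ∈ Icc (0 : ℝ) 1, |A x| ≤ 3 * K ^ 2 / N ^ 2 := fun x hx => by
    have e : A x = (interp N f x - f x) * g x + f x * (interp N g x - g x)
        + (interp N f x - f x) * (interp N g x - g x) := by
      simp only [hA, Pi.sub_apply, Pi.mul_apply]
      ring
    have i1 := hf.interp_error hf.b2 hN hx
    have i2 := hg.interp_error hg.b2 hN hx
    have i3 : K / (N : ℝ) ^ 2 ≤ K := div_le_self hK (one_le_pow₀ hN1)
    have t1 := mul_le_mul i1 (hg.b0 x hx) (abs_nonneg _) (by positivity)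
    have t2 := mul_le_mul (hf.b0 x hx) i2 (abs_nonneg _) hK
    have t3 := mul_le_mul (i1.trans i3) i2 (abs_nonneg _) hK
    rw [← abs_mul] at t1 t2 t3
    rw [e]
    refine (abs_add_three _ _ _).trans ((add_le_add (add_le_add t1 t2) t3).trans (le_of_eq ?_))
    ring
  have hA2 : ∀ j, j + 1 < N → ∀ x ∈ Icc ((j : ℝ) / N) (((j : ℝ) + 1) / N),
      |A (x + 1 / N) - A x| ≤ 6 * K ^ 2 / N ^ 3 := fun j hj x hx => by
    have hx0 := cell_subset ((Nat.lt_succ_self j).trans hj) hx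
    have hx1 : x + 1 / N ∈ Icc (0 : ℝ) 1 := cell_subset hj (by
      push_cast
      rw [add_div ((j : ℝ) + 1)]
      refine ⟨?_, by linarith [hx.2]⟩
      rw [add_div]
      linarith [hx.1])
    have s1 := hf.error_shift hj hx
    have s2 := hg.error_shift hj hx
    have i1 := hf.interp_error hf.b2 hN hx0
    have i2 := hg.interp_error hg.b2 hN hx1
    have l1 := abs_sub_le_of_hasDerivWithinAt hf.d0 hf.b1 hx0 hx1
    have l2 := abs_sub_le_of_hasDerivWithinAt hg.d0 hg.b1 hx0 hx1
    rw [add_sub_cancel_left, abs_of_pos (one_div_pos.2 hN')] at l1 l2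
    have i3 : K / (N : ℝ) ^ 2 ≤ K := div_le_self hK (one_le_pow₀ hN1)
    have e : A (x + 1 / N) - A x =
        ((interp N f (x + 1 / N) - f (x + 1 / N)) - (interp N f x - f x)) * g (x + 1 / N)
        + (interp N f x - f x) * (g (x + 1 / N) - g x)
        + (f (x + 1 / N) - f x) * (interp N g (x + 1 / N) - g (x + 1 / N))
        + f x * ((interp N g (x + 1 / N) - g (x + 1 / N)) - (interp N g x - g x))
        + ((interp N f (x + 1 / N) - f (x + 1 / N)) - (interp N f x - f x))
          * (interp N g (x + 1 / N) - g (x + 1 / N))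
        + (interp N f x - f x)
          * ((interp N g (x + 1 / N) - g (x + 1 / N)) - (interp N g x - g x)) := by
      simp only [hA, Pi.sub_apply, Pi.mul_apply]
      ring
    have t1 := mul_le_mul s1 (hg.b0 _ hx1) (abs_nonneg _) (by positivity)
    have t2 := mul_le_mul i1 l2 (abs_nonneg _) (by positivity)
    have t3 := mul_le_mul l1 i2 (abs_nonneg _) (by positivity)
    have t4 := mul_le_mul (hf.b0 _ hx0) s2 (abs_nonneg _) hK
    have t5 := mul_le_mul s1 (i2.trans i3) (abs_nonneg _) (by positivity)
    have t6 := mul_le_mul (i1.trans i3) s2 (abs_nonneg _) hK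
    rw [← abs_mul] at t1 t2 t3 t4 t5 t6
    rw [e]
    have := add_le_add (add_le_add (add_le_add (add_le_add (add_le_add t1 t2) t3) t4) t5) t6
    refine le_trans ?_ (this.trans (le_of_eq ?_))
    · refine (abs_add_le _ _).trans (add_le_add ?_ le_rfl)
      refine (abs_add_le _ _).trans (add_le_add ?_ le_rfl)
      refine (abs_add_le _ _).trans (add_le_add ?_ le_rfl)
      exact abs_add_three _ _ _
    · field_simp
      ring
  obtain ⟨n, rfl⟩ : ∃ n, N = n + 1 := ⟨N - 1, (Nat.succ_pred_eq_of_pos hN).symm⟩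
  set h : ℝ := ((n + 1 : ℕ) : ℝ) with hh
  set b : ℕ → ℝ := fun j => h * ∫ x in ((j : ℝ) / h)..(((j : ℝ) + 1) / h), A x with hb
  have hlen : ∀ j : ℕ, |((j : ℝ) + 1) / h - (j : ℝ) / h| = 1 / h := fun j => by
    rw [← sub_div, add_sub_cancel_left, abs_of_pos (one_div_pos.2 hN')]
  have hb1 : ∀ j ≤ n, |b j| ≤ 3 * K ^ 2 / h ^ 2 := fun j hj => by
    have := intervalIntegral.norm_integral_le_of_norm_le_const (a := (j : ℝ) / h)
      (b := ((j : ℝ) + 1) / h) (f := A) (C := 3 * K ^ 2 / h ^ 2) fun x hx => by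
        rw [uIoc_of_le (cell_lt hN j).le] at hx
        exact hA1 x (cell_subset (Nat.lt_succ_of_le hj) (Ioc_subset_Icc_self hx))
    rw [hlen, Real.norm_eq_abs] at this
    rw [hb, abs_mul, abs_of_pos hN']
    refine (mul_le_mul_of_nonneg_left this hN'.le).trans (le_of_eq ?_)
    field_simp
  have hb2 : ∀ j < n, |b (j + 1) - b j| ≤ 6 * K ^ 2 / h ^ 3 := fun j hj => by
    have hj1 : j + 1 < n + 1 := Nat.succ_lt_succ hj
    have hj0 : j < n + 1 := (Nat.lt_succ_self j).trans hj1
    have e1 : ∫ x in ((j + 1 : ℕ) : ℝ) / h..(((j + 1 : ℕ) : ℝ) + 1) / h, A x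
        = ∫ x in (j : ℝ) / h..((j : ℝ) + 1) / h, A (x + 1 / h) := by
      rw [intervalIntegral.integral_comp_add_right]
      push_cast
      rw [← add_div, ← add_div]
    have e2 : b (j + 1) - b j
        = h * ∫ x in (j : ℝ) / h..((j : ℝ) + 1) / h, (A (x + 1 / h) - A x) := by
      simp only [hb]
      rw [e1, ← mul_sub, intervalIntegral.integral_sub]
      · have := (hAb.intervalIntegrable (cell_lt hN (j + 1)).le
          (cell_subset hj1)).comp_add_right (1 / h)
        rw [← hh] at this
        convert this using 1
        · push_cast; rw [add_div]; ring
        · push_cast; rw [add_div ((j : ℝ) + 1)]; ring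
      · exact hAb.intervalIntegrable (cell_lt hN j).le (cell_subset hj0)
    have := intervalIntegral.norm_integral_le_of_norm_le_const (a := (j : ℝ) / h)
      (b := ((j : ℝ) + 1) / h) (f := fun x => A (x + 1 / h) - A x) (C := 6 * K ^ 2 / h ^ 3)
      fun x hx => by
        rw [uIoc_of_le (cell_lt hN j).le] at hx
        exact hA2 j hj1 x (Ioc_subset_Icc_self hx)
    rw [hlen, Real.norm_eq_abs] at this
    rw [e2, abs_mul, abs_of_pos hN']
    refine (mul_le_mul_of_nonneg_left this hN'.le).trans (le_of_eq ?_)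
    field_simp
  have hφm : ∀ j ≤ n + 1, |φ ((j : ℝ) / h)| ≤ 2 * √h * normL2 φ := fun j hj =>
    S.abs_le hN hφ ⟨by positivity, by
      rw [div_le_one hN', hh]
      exact_mod_cast hj⟩
  have main := abs_sum_diff_mul_le (φ := fun j => φ ((j : ℝ) / h)) hφm hb1 hb2
  have e : ip A (deriv φ)
      = ∑ j ∈ Finset.range (n + 1), (φ (((j + 1 : ℕ) : ℝ) / h) - φ ((j : ℝ) / h)) * b j := by
    rw [ip_deriv_S hN hAb hφ]
    refine Finset.sum_congr rfl fun j _ => ?_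
    simp only [hb, slopeOn, ← hh, Nat.cast_add, Nat.cast_one]
    ring
  rw [e]
  refine main.trans ?_
  have hn : (n : ℝ) ≤ h := by rw [hh]; push_cast; linarith
  have h1 : 2 * (3 * K ^ 2 / h ^ 2) + n * (6 * K ^ 2 / h ^ 3) ≤ 12 * K ^ 2 / h ^ 2 := by
    have : n * (6 * K ^ 2 / h ^ 3) ≤ h * (6 * K ^ 2 / h ^ 3) := by gcongr
    refine (add_le_add le_rfl this).trans (le_of_eq ?_)
    field_simp
    ring
  have h2 := normL2_nonneg φ
  refine (mul_le_mul_of_nonneg_left h1 (by positivity)).trans (le_of_eq ?_)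
  ring

/-! ### One step of the scheme -/

/-- The error equation of the mass balance. Here `θ` and `ξ` are the differences between the discrete
solution and the interpolants of the exact one at some time level, `δ` is the increment of `θ`, `v`
that of the exact first component, `f q` with `f = 1 + α p` is the flux, and `ρ` is the sum of the
truncation error in time and of the interpolation error of `v`. -/
lemma mass_error_eq {N : ℕ} (hN : 0 < N) {α k : ℝ} {p f f₁ f₂ q q₁ q₂ v θ ξ δ φ : ℝ → ℝ}
    (hf : HasDerivs f f₁ f₂) (hfp : ∀ x, f x = 1 + α * p x) (hq : HasDerivs q q₁ q₂)
    (hq0 : q 0 = 0) (hq1 : q 1 = 0) (hθ : θ ∈ S N) (hξ : ξ ∈ S0 N) (hδ : δ ∈ S N) (hφ : φ ∈ S N)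
    (heq : ip (interp N v + δ) φ + k * ip (deriv (interp N q + ξ)) φ
      + k * α * ip (deriv ((interp N p + θ) * (interp N q + ξ))) φ = 0) :
    ip δ φ = k * (ip (interp N f * interp N q - f * q) (deriv φ)
        + α * ip (θ * (interp N q + ξ)) (deriv φ) + ip (interp N f * ξ) (deriv φ))
      - ip (interp N v + k • (f₁ * q + f * q₁)) φ := by
  have Pφ := S.pwC1 hN hφ
  have Pθ := S.pwC1 hN hθ
  have Pξ := S.pwC1 hN hξ.1
  have PIq := S.pwC1 hN (interp_mem N q)
  have PIp := S.pwC1 hN (interp_mem N p)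
  have PIf := S.pwC1 hN (interp_mem N f)
  have PIv := S.pwC1 hN (interp_mem N v)
  have PU := PIq.add Pξ
  have PF := hf.pwC1.mul hq.pwC1
  have hU0 : (interp N q + ξ) 0 = 0 := by simp [interp_zero hN, hq0, hξ.2.1]
  have hU1 : (interp N q + ξ) 1 = 0 := by simp [interp_one hN, hq1, hξ.2.2]
  have hIf : EqOn (1 + α • interp N p) (interp N f) (Icc 0 1) := by
    refine S.eqOn_interp hN (S.add ?_ (S.smul α (interp_mem N p))) fun i hi => ?_
    · exact ⟨continuousOn_const, fun j _ => ⟨0, 1, fun x _ => by simp⟩⟩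
    · simp [interp_node hN p hi, hfp]
  have hF1 : deriv (f * q) =ᵐ[unitVol] f₁ * q + f * q₁ :=
    deriv_ae_eq_of_hasDerivWithinAt fun x hx => (hf.d0 x hx).mul (hq.d0 x hx)
  have eF := PF.ip_deriv_right_of_zero Pφ (by simp [hq0]) (by simp [hq1])
  rw [ip_congr hF1 ae_eq_rfl] at eF
  have e1 := PU.ip_deriv_right_of_zero Pφ hU0 hU1
  have e2 := ((PIp.add Pθ).mul PU).ip_deriv_right_of_zero Pφ
    (by rw [Pi.mul_apply, hU0, mul_zero]) (by rw [Pi.mul_apply, hU1, mul_zero])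
  have BF1 : EssBdd (f₁ * q + f * q₁) := PF.essBdd_deriv.congr hF1
  have e3 : ip ((interp N q + ξ) + α • ((interp N p + θ) * (interp N q + ξ))) (deriv φ)
      = ip ((interp N f * interp N q - f * q) + α • (θ * (interp N q + ξ)) + interp N f * ξ + f * q)
        (deriv φ) := by
    refine ip_congr (ae_of_Icc fun x hx => ?_) ae_eq_rfl
    have := hIf hx
    simp only [Pi.add_apply, Pi.mul_apply, Pi.smul_apply, Pi.sub_apply, smul_eq_mul,
      Pi.one_apply] at this ⊢
    rw [← this]
    ring
  have Bφ' := Pφ.essBdd_deriv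
  have B1 : EssBdd (interp N f * interp N q - f * q) := ((PIf.mul PIq).sub PF).essBdd
  have B2 : EssBdd (α • (θ * (interp N q + ξ))) := ((Pθ.mul PU).smul α).essBdd
  have B3 : EssBdd (interp N f * ξ) := (PIf.mul Pξ).essBdd
  rw [ip_add_left PU.essBdd (((PIp.add Pθ).mul PU).smul α).essBdd Bφ', ip_smul_left,
    ip_add_left ((B1.add B2).add B3) PF.essBdd Bφ', ip_add_left (B1.add B2) B3 Bφ',
    ip_add_left B1 B2 Bφ', ip_smul_left] at e3
  rw [ip_add_left PIv.essBdd (BF1.smul k) Pφ.essBdd, ip_smul_left]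
  rw [ip_add_left PIv.essBdd (S.pwC1 hN hδ).essBdd Pφ.essBdd] at heq
  linear_combination heq + k * e3 - k * e1 - k * α * e2 + k * eF

/-- The setting of the estimates for one step of the mass balance, with notation as in
`mass_error_eq`: a common bound `K ≥ 2` for the coefficient and the exact solution, the size of the
truncation error, and errors `θ`, `ξ` which are at most `1` in absolute value. -/
structure MassStep (N : ℕ) (K α k : ℝ) (p f f₁ f₂ f₃ q q₁ q₂ q₃ v v₁ v₂ θ ξ δ : ℝ → ℝ) : Prop where
  hN : 0 < N
  hK : 2 ≤ K
  hα : |α| ≤ K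
  hk : 0 ≤ k
  hf : HasBddDerivs K f f₁ f₂ f₃
  hfp : ∀ x, f x = 1 + α * p x
  hq : HasBddDerivs K q q₁ q₂ q₃
  hq0 : q 0 = 0
  hq1 : q 1 = 0
  hv : HasDerivs v v₁ v₂
  hv2 : ∀ x ∈ Icc (0 : ℝ) 1, |v₂ x| ≤ K * k
  htrunc : ∀ x ∈ Icc (0 : ℝ) 1, |v x + k * (f₁ x * q x + f x * q₁ x)| ≤ K * k ^ 2
  hθ : θ ∈ S N
  hξ : ξ ∈ S0 N
  hδ : δ ∈ S N
  hθ1 : ∀ x ∈ Icc (0 : ℝ) 1, |θ x| ≤ 1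
  hξ1 : ∀ x ∈ Icc (0 : ℝ) 1, |ξ x| ≤ 1
  heq : ∀ φ ∈ S N, ip (interp N v + δ) φ + k * ip (deriv (interp N q + ξ)) φ
      + k * α * ip (deriv ((interp N p + θ) * (interp N q + ξ))) φ = 0

section MassStep

variable {N : ℕ} {K α k : ℝ} {p f f₁ f₂ f₃ q q₁ q₂ q₃ v v₁ v₂ θ ξ δ : ℝ → ℝ}

lemma MassStep.normL2_theta_deriv_le (h : MassStep N K α k p f f₁ f₂ f₃ q q₁ q₂ q₃ v v₁ v₂ θ ξ δ) :
    normL2 (θ * deriv (interp N q + ξ)) ≤ 2 * K * normL2 θ + 2 * normH1 ξ := by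
  have PIq := S.pwC1 h.hN (interp_mem N q)
  have Pθ := S.pwC1 h.hN h.hθ
  have Pξ := S.pwC1 h.hN h.hξ.1
  have hK := h.hK
  have e : θ * deriv (interp N q + ξ) =ᵐ[unitVol] deriv (interp N q) * θ + θ * deriv ξ := by
    filter_upwards [PIq.deriv_add_ae Pξ] with x hx
    simp only [Pi.mul_apply, Pi.add_apply] at hx ⊢
    rw [hx]
    ring
  rw [normL2_congr e]
  refine (normL2_add_le (PIq.essBdd_deriv.mul Pθ.essBdd) (Pθ.essBdd.mul Pξ.essBdd_deriv)).trans ?_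
  refine add_le_add (normL2_mul_le PIq.essBdd_deriv Pθ.essBdd (by linarith)
    (h.hq.interp_deriv_bound h.hN h.hq.b1 h.hq.b2)) ?_
  refine (normL2_mul_le Pθ.essBdd Pξ.essBdd_deriv zero_le_one (ae_of_Icc h.hθ1)).trans ?_
  rw [one_mul]
  exact normL2_deriv_le_normH1 ξ

/-- All contributions to the mass error equation except the transport of `θ`. -/
lemma MassStep.abs_ip_sub_le (h : MassStep N K α k p f f₁ f₂ f₃ q q₁ q₂ q₃ v v₁ v₂ θ ξ δ)
    {φ : ℝ → ℝ} (hφ : φ ∈ S N) :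
    |ip δ φ - k * α * ip (θ * (interp N q + ξ)) (deriv φ)|
      ≤ k * (25 * K ^ 2 * (k + √N / N ^ 2) + 6 * K * normH1 ξ) * normL2 φ := by
  have hN := h.hN
  have hN' : (0 : ℝ) < N := by exact_mod_cast hN
  have hN1 : (1 : ℝ) ≤ N := by exact_mod_cast hN
  have hK := h.hK
  have hk := h.hk
  have Pφ := S.pwC1 hN hφ
  have Pξ := S.pwC1 hN h.hξ.1
  have PIf := S.pwC1 hN (interp_mem N f)
  have PIv := S.pwC1 hN (interp_mem N v)
  have hX := normL2_nonneg φ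
  have hY := normH1_nonneg ξ
  have e := mass_error_eq hN h.hf.toHasDerivs h.hfp h.hq.toHasDerivs h.hq0 h.hq1 h.hθ h.hξ h.hδ hφ
    (h.heq φ hφ)
  have b1 := abs_ip_flux_error_le hN h.hf h.hq hφ
  have b2 : |ip (interp N f * ξ) (deriv φ)| ≤ 6 * K * normH1 ξ * normL2 φ := by
    rw [(PIf.mul Pξ).ip_deriv_right_of_zero Pφ (by simp [h.hξ.2.1]) (by simp [h.hξ.2.2]), abs_neg]
    refine (abs_ip_le (PIf.mul Pξ).essBdd_deriv Pφ.essBdd).trans ?_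
    refine mul_le_mul_of_nonneg_right ?_ hX
    rw [normL2_congr (PIf.deriv_mul_ae Pξ)]
    refine (normL2_add_le (PIf.essBdd_deriv.mul Pξ.essBdd)
      (PIf.essBdd.mul Pξ.essBdd_deriv)).trans ?_
    have c1 := normL2_mul_le PIf.essBdd_deriv Pξ.essBdd (by linarith)
      (h.hf.interp_deriv_bound hN h.hf.b1 h.hf.b2)
    have c2 := normL2_mul_le PIf.essBdd Pξ.essBdd_deriv (c := 2 * K) (by linarith)
      (ae_of_Icc fun x hx => h.hf.interp_bound hN h.hf.b0 h.hf.b2 hx)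
    have c3 := mul_le_mul_of_nonneg_left (normL2_le_normH1 ξ) (by linarith : 0 ≤ 2 * K)
    have c4 := mul_le_mul_of_nonneg_left (normL2_deriv_le_normH1 ξ) (by linarith : 0 ≤ 2 * K)
    linarith
  have hF1 : deriv (f * q) =ᵐ[unitVol] f₁ * q + f * q₁ :=
    deriv_ae_eq_of_hasDerivWithinAt fun x hx => (h.hf.d0 x hx).mul (h.hq.d0 x hx)
  have BF1 := (h.hf.pwC1.mul h.hq.pwC1).essBdd_deriv.congr hF1
  have b3 : |ip (interp N v + k • (f₁ * q + f * q₁)) φ|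
      ≤ K * k * (k + √N / N ^ 2) * normL2 φ := by
    refine (abs_ip_le (PIv.essBdd.add (BF1.smul k)) Pφ.essBdd).trans ?_
    refine mul_le_mul_of_nonneg_right ?_ hX
    refine normL2_le_of_bound (PIv.essBdd.add (BF1.smul k)) (by positivity) (ae_of_Icc ?_)
    intro x hx
    have i1 := h.hv.interp_error h.hv2 hN hx
    have i2 := h.htrunc x hx
    have i3 := abs_add_le (interp N v x - v x) (v x + k * (f₁ x * q x + f x * q₁ x))
    have i4 : K * k / (N : ℝ) ^ 2 ≤ K * k * (√N / N ^ 2) := by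
      rw [← mul_div_assoc]
      refine div_le_div_of_nonneg_right ?_ (by positivity)
      exact le_mul_of_one_le_right (by positivity) (Real.one_le_sqrt.2 hN1)
    simp only [Pi.add_apply, Pi.mul_apply, Pi.smul_apply, smul_eq_mul]
    rw [show interp N v x + k * (f₁ x * q x + f x * q₁ x)
      = (interp N v x - v x) + (v x + k * (f₁ x * q x + f x * q₁ x)) by ring]
    nlinarith
  have e' : ip δ φ - k * α * ip (θ * (interp N q + ξ)) (deriv φ)
      = k * ip (interp N f * interp N q - f * q) (deriv φ) + k * ip (interp N f * ξ) (deriv φ)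
        - ip (interp N v + k • (f₁ * q + f * q₁)) φ := by
    rw [e]
    ring
  rw [e']
  refine (abs_sub _ _).trans ((add_le_add (abs_add_le _ _) le_rfl).trans ?_)
  rw [abs_mul, abs_mul, abs_of_nonneg hk]
  have d1 := mul_le_mul_of_nonneg_left b1 hk
  have d2 := mul_le_mul_of_nonneg_left b2 hk
  have d3 : K * k * (k + √N / N ^ 2) * normL2 φ ≤ K ^ 2 * k * (k + √N / N ^ 2) * normL2 φ := by
    gcongr
    nlinarith
  have d4 : k * (24 * K ^ 2 * (√N / N ^ 2) * normL2 φ)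
      ≤ k * (24 * K ^ 2 * (k + √N / N ^ 2) * normL2 φ) := by
    gcongr
    linarith
  nlinarith

/-- The energy term of the mass balance: the transport term is skew up to the derivative of the
velocity. -/
lemma MassStep.ip_self_le (h : MassStep N K α k p f f₁ f₂ f₃ q q₁ q₂ q₃ v v₁ v₂ θ ξ δ) :
    |ip δ θ| ≤ 32 * K ^ 2 * k * (normL2 θ + normH1 ξ + (k + √N / N ^ 2)) * normL2 θ := by
  have hN := h.hN
  have hK := h.hK
  have hk := h.hk
  have PIq := S.pwC1 hN (interp_mem N q)
  have Pθ := S.pwC1 hN h.hθ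
  have Pξ := S.pwC1 hN h.hξ.1
  have PU := PIq.add Pξ
  have hX := normL2_nonneg θ
  have hY := normH1_nonneg ξ
  have hR : 0 ≤ k + √N / (N : ℝ) ^ 2 := by positivity
  have e : ip (θ * (interp N q + ξ)) (deriv θ) = -(1 / 2) * ip (θ * deriv (interp N q + ξ)) θ := by
    have e1 := PU.ip_deriv_right_of_zero (Pθ.mul Pθ) (by simp [interp_zero hN, h.hq0, h.hξ.2.1])
      (by simp [interp_one hN, h.hq1, h.hξ.2.2])
    have e2 : ip (interp N q + ξ) (deriv (θ * θ)) = 2 * ip (θ * (interp N q + ξ)) (deriv θ) := by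
      rw [← ip_smul_left]
      rw [ip_eq_integral, ip_eq_integral]
      refine integral_congr_ae ?_
      filter_upwards [Pθ.deriv_mul_ae Pθ] with x hx
      rw [hx]
      simp only [Pi.mul_apply, Pi.add_apply, Pi.smul_apply, smul_eq_mul]
      ring
    have e3 : ip (deriv (interp N q + ξ)) (θ * θ) = ip (θ * deriv (interp N q + ξ)) θ := by
      rw [← ip_mul_assoc, mul_comm]
    rw [e2, e3] at e1
    linarith
  have b1 : |ip (θ * (interp N q + ξ)) (deriv θ)| ≤ (K * normL2 θ + normH1 ξ) * normL2 θ := by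
    rw [e, abs_mul]
    have := (abs_ip_le (Pθ.essBdd.mul PU.essBdd_deriv) Pθ.essBdd).trans
      (mul_le_mul_of_nonneg_right h.normL2_theta_deriv_le hX)
    rw [show |(-(1 / 2) : ℝ)| = 1 / 2 by norm_num [abs_of_neg]]
    linarith
  have b2 := h.abs_ip_sub_le h.hθ
  have b3 := abs_add_le (ip δ θ - k * α * ip (θ * (interp N q + ξ)) (deriv θ))
    (k * α * ip (θ * (interp N q + ξ)) (deriv θ))
  rw [sub_add_cancel, abs_mul, abs_mul, abs_of_nonneg hk] at b3
  have b4 : k * |α| * |ip (θ * (interp N q + ξ)) (deriv θ)|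
      ≤ k * K * ((K * normL2 θ + normH1 ξ) * normL2 θ) := by
    have := h.hα
    gcongr
  refine b3.trans ((add_le_add b2 b4).trans ?_)
  have : (25 * K ^ 2 * (k + √N / N ^ 2) + 6 * K * normH1 ξ) + K * (K * normL2 θ + normH1 ξ)
      ≤ 32 * K ^ 2 * (normL2 θ + normH1 ξ + (k + √N / N ^ 2)) := by
    have := mul_nonneg (by positivity : 0 ≤ K ^ 2) hR
    have := mul_nonneg (by positivity : 0 ≤ K ^ 2) hX
    have : K * normH1 ξ ≤ K ^ 2 * normH1 ξ := by gcongr; nlinarith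
    nlinarith
  have := mul_le_mul_of_nonneg_left (mul_le_mul_of_nonneg_right this hX) hk
  nlinarith

/-- The increment of the mass error; the inverse inequality costs a factor `N = 1 / h`. -/
lemma MassStep.normL2_incr_le (h : MassStep N K α k p f f₁ f₂ f₃ q q₁ q₂ q₃ v v₁ v₂ θ ξ δ) :
    normL2 δ ≤ 32 * K ^ 2 * k * (N * normL2 θ + normH1 ξ + (k + √N / N ^ 2)) := by
  have hN := h.hN
  have hN1 : (1 : ℝ) ≤ N := by exact_mod_cast hN
  have hK := h.hK
  have hk := h.hk
  have PIq := S.pwC1 hN (interp_mem N q)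
  have Pθ := S.pwC1 hN h.hθ
  have Pξ := S.pwC1 hN h.hξ.1
  have Pδ := S.pwC1 hN h.hδ
  have PU := PIq.add Pξ
  have hX := normL2_nonneg θ
  have hY := normH1_nonneg ξ
  have hD := normL2_nonneg δ
  have hR : 0 ≤ k + √N / (N : ℝ) ^ 2 := by positivity
  have b1 : |ip (θ * (interp N q + ξ)) (deriv δ)|
      ≤ (14 * K * N * normL2 θ + 2 * normH1 ξ) * normL2 δ := by
    rw [(Pθ.mul PU).ip_deriv_right_of_zero Pδ (by simp [interp_zero hN, h.hq0, h.hξ.2.1])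
      (by simp [interp_one hN, h.hq1, h.hξ.2.2]), abs_neg]
    refine (abs_ip_le (Pθ.mul PU).essBdd_deriv Pδ.essBdd).trans ?_
    refine mul_le_mul_of_nonneg_right ?_ hD
    rw [normL2_congr (Pθ.deriv_mul_ae PU)]
    refine (normL2_add_le (Pθ.essBdd_deriv.mul PU.essBdd)
      (Pθ.essBdd.mul PU.essBdd_deriv)).trans ?_
    have c1 : normL2 (deriv θ * (interp N q + ξ)) ≤ 3 * K * (4 * N * normL2 θ) := by
      rw [mul_comm (deriv θ)]
      refine (normL2_mul_le PU.essBdd Pθ.essBdd_deriv (c := 3 * K) (by linarith)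
        (ae_of_Icc fun x hx => ?_)).trans
        (mul_le_mul_of_nonneg_left (S.normL2_deriv_le hN h.hθ) (by linarith))
      refine (abs_add_le _ _).trans ?_
      have := h.hq.interp_bound hN h.hq.b0 h.hq.b2 hx
      have := h.hξ1 x hx
      linarith
    have c2 := h.normL2_theta_deriv_le
    have c3 : K * normL2 θ ≤ K * N * normL2 θ := by
      gcongr
      nlinarith
    nlinarith
  have b2 := h.abs_ip_sub_le h.hδ
  have b3 := abs_add_le (ip δ δ - k * α * ip (θ * (interp N q + ξ)) (deriv δ))
    (k * α * ip (θ * (interp N q + ξ)) (deriv δ))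
  rw [sub_add_cancel, abs_mul, abs_mul, abs_of_nonneg hk, abs_of_nonneg (ip_self_nonneg δ)] at b3
  have b4 : k * |α| * |ip (θ * (interp N q + ξ)) (deriv δ)|
      ≤ k * K * ((14 * K * N * normL2 θ + 2 * normH1 ξ) * normL2 δ) := by
    have := h.hα
    gcongr
  have b5 : normL2 δ ^ 2
      ≤ 32 * K ^ 2 * k * (N * normL2 θ + normH1 ξ + (k + √N / N ^ 2)) * normL2 δ := by
    rw [normL2_sq]
    refine b3.trans ((add_le_add b2 b4).trans ?_)
    have : (25 * K ^ 2 * (k + √N / N ^ 2) + 6 * K * normH1 ξ)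
        + K * (14 * K * N * normL2 θ + 2 * normH1 ξ)
        ≤ 32 * K ^ 2 * (N * normL2 θ + normH1 ξ + (k + √N / N ^ 2)) := by
      have := mul_nonneg (by positivity : 0 ≤ K ^ 2) hR
      have := mul_nonneg (by positivity : 0 ≤ K ^ 2 * N) hX
      have : K * normH1 ξ ≤ K ^ 2 * normH1 ξ := by gcongr; nlinarith
      nlinarith
    have := mul_le_mul_of_nonneg_left (mul_le_mul_of_nonneg_right this hD) hk
    nlinarith
  rcases hD.eq_or_lt with h0 | h0
  · rw [← h0]
    positivity
  · rw [pow_two] at b5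
    exact le_of_mul_le_mul_right b5 h0

end MassStep

/-- The error equation of the momentum balance. Here `ε` is the increment of `ξ`, `z` that of the
exact velocity, and the nonlinear terms are written as derivatives of `p + β q² / 2 + γ p² / 2`. The
second derivative `z₂` enters because `a(z, χ) = (z - z₂ / 3, χ)`. -/
lemma momentum_error_eq {N : ℕ} (hN : 0 < N) {β γ k : ℝ}
    {p p₁ p₂ q q₁ q₂ z z₁ z₂ θ ξ ε χ : ℝ → ℝ} (hp : HasDerivs p p₁ p₂) (hq : HasDerivs q q₁ q₂)
    (hz : HasDerivs z z₁ z₂) {L : ℝ} (hz2 : ∀ x ∈ Icc (0 : ℝ) 1, |z₂ x| ≤ L)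
    (hθ : θ ∈ S N) (hξ : ξ ∈ S0 N) (hε : ε ∈ S0 N) (hχ : χ ∈ S0 N)
    (heq : a (interp N z + ε) χ + k * ip (deriv (interp N p + θ)) χ
      + k * β * ip ((interp N q + ξ) * deriv (interp N q + ξ)) χ
      + k * γ * ip ((interp N p + θ) * deriv (interp N p + θ)) χ = 0) :
    a ε χ = k * ip ((1 + (γ / 2) • (interp N p + θ + p)) * (interp N p + θ - p)
        + (β / 2) • ((interp N q + ξ + q) * (interp N q + ξ - q))) (deriv χ)
      - ip (interp N z - (1 / 3 : ℝ) • z₂ + k • (p₁ + β • (q * q₁) + γ • (p * p₁))) χ := by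
  have Pχ := S.pwC1 hN hχ.1
  have Pε := S.pwC1 hN hε.1
  have PIz := S.pwC1 hN (interp_mem N z)
  have PH := (S.pwC1 hN (interp_mem N p)).add (S.pwC1 hN hθ)
  have PU := (S.pwC1 hN (interp_mem N q)).add (S.pwC1 hN hξ.1)
  have Pp := hp.pwC1
  have Pq := hq.pwC1
  have Pz := hz.pwC1
  have Pz1 : PwC1 z₁ := PwC1.of_hasDerivWithinAt hz.d1 hz2
  have ez1 := deriv_ae_eq_of_hasDerivWithinAt hz.d0
  have ez2 := deriv_ae_eq_of_hasDerivWithinAt hz.d1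
  have Bz2 : EssBdd z₂ := Pz1.essBdd_deriv.congr ez2
  have Bp1 : EssBdd p₁ := Pp.essBdd_deriv.congr (deriv_ae_eq_of_hasDerivWithinAt hp.d0)
  have Bq1 : EssBdd q₁ := Pq.essBdd_deriv.congr (deriv_ae_eq_of_hasDerivWithinAt hq.d0)
  -- integration by parts for each gradient and each square
  have parts : ∀ {f f' : ℝ → ℝ}, PwC1 f → deriv f =ᵐ[unitVol] f' →
      ip f (deriv χ) = -ip f' χ := fun {f f'} hf hf' => by
    have := Pχ.ip_deriv_right_of_zero hf hχ.2.1 hχ.2.2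
    rw [ip_comm, ip_congr hf' ae_eq_rfl] at this
    rw [ip_comm f]
    linarith
  have sq : ∀ {f f' : ℝ → ℝ}, PwC1 f → deriv f =ᵐ[unitVol] f' →
      ip (f * f) (deriv χ) = -(2 * ip (f * f') χ) := fun {f f'} hf hf' => by
    rw [← ip_smul_left]
    refine parts (hf.mul hf) ?_
    filter_upwards [hf.deriv_mul_ae hf, hf'] with x h1 h2
    rw [h1]
    simp only [Pi.add_apply, Pi.mul_apply, Pi.smul_apply, smul_eq_mul, h2]
    ring
  have e1 := parts PH ae_eq_rfl
  have e2 := sq PU ae_eq_rfl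
  have e3 := sq PH ae_eq_rfl
  have e4 := parts Pp (deriv_ae_eq_of_hasDerivWithinAt hp.d0)
  have e5 := sq Pq (deriv_ae_eq_of_hasDerivWithinAt hq.d0)
  have e6 := sq Pp (deriv_ae_eq_of_hasDerivWithinAt hp.d0)
  have e7 := parts Pz1 ez2
  have ea : a (interp N z) χ = ip (interp N z) χ - 1 / 3 * ip z₂ χ := by
    have h1 := ip_deriv_interp_error hN Pz hχ.1
    rw [ip_congr (PIz.deriv_sub_ae Pz) ae_eq_rfl,
      ip_sub_left PIz.essBdd_deriv Pz.essBdd_deriv Pχ.essBdd_deriv, ip_congr ez1 ae_eq_rfl] at h1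
    rw [a]
    linear_combination 1 / 3 * h1 + 1 / 3 * e7
  have eG : ip ((1 + (γ / 2) • (interp N p + θ + p)) * (interp N p + θ - p)
        + (β / 2) • ((interp N q + ξ + q) * (interp N q + ξ - q))) (deriv χ)
      = ip (interp N p + θ) (deriv χ) - ip p (deriv χ)
        + γ / 2 * (ip ((interp N p + θ) * (interp N p + θ)) (deriv χ) - ip (p * p) (deriv χ))
        + β / 2 * (ip ((interp N q + ξ) * (interp N q + ξ)) (deriv χ) - ip (q * q) (deriv χ)) := by
    have Bχ := Pχ.essBdd_deriv
    have BH := PH.essBdd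
    have BHH := (PH.mul PH).essBdd
    have BUU := (PU.mul PU).essBdd
    have Bp := Pp.essBdd
    have Bpp := (Pp.mul Pp).essBdd
    have Bqq := (Pq.mul Pq).essBdd
    rw [← ip_sub_left BH Bp Bχ, ← ip_sub_left BHH Bpp Bχ, ← ip_sub_left BUU Bqq Bχ,
      ← ip_smul_left, ← ip_smul_left,
      ← ip_add_left (BH.sub Bp) ((BHH.sub Bpp).smul _) Bχ,
      ← ip_add_left ((BH.sub Bp).add ((BHH.sub Bpp).smul _)) ((BUU.sub Bqq).smul _) Bχ]
    congr 1
    ext x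
    simp only [Pi.add_apply, Pi.mul_apply, Pi.smul_apply, Pi.sub_apply, smul_eq_mul, Pi.one_apply]
    ring
  have Bχ := Pχ.essBdd
  have Bpp1 : EssBdd (γ • (p * p₁)) := (Pp.essBdd.mul Bp1).smul γ
  have Bqq1 : EssBdd (β • (q * q₁)) := (Pq.essBdd.mul Bq1).smul β
  rw [eG, ip_add_left (PIz.essBdd.sub (Bz2.smul _)) (((Bp1.add Bqq1).add Bpp1).smul k) Bχ,
    ip_sub_left PIz.essBdd (Bz2.smul _) Bχ, ip_smul_left, ip_smul_left,
    ip_add_left (Bp1.add Bqq1) Bpp1 Bχ, ip_add_left Bp1 Bqq1 Bχ, ip_smul_left, ip_smul_left]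
  rw [a_add_left PIz Pε Pχ, ea] at heq
  linear_combination heq - k * e1 - k * β / 2 * e2 - k * γ / 2 * e3 + k * e4 + k * β / 2 * e5
    + k * γ / 2 * e6

/-- The setting of the estimate for one step of the momentum balance, with notation as in
`momentum_error_eq`. -/
structure MomentumStep (N : ℕ) (K β γ k : ℝ)
    (p p₁ p₂ p₃ q q₁ q₂ q₃ z z₁ z₂ θ ξ ε : ℝ → ℝ) : Prop where
  hN : 0 < N
  hK : 2 ≤ K
  hβ : |β| ≤ K
  hγ : |γ| ≤ K
  hk : 0 ≤ k
  hp : HasBddDerivs K p p₁ p₂ p₃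
  hq : HasBddDerivs K q q₁ q₂ q₃
  hz : HasDerivs z z₁ z₂
  hz2 : ∀ x ∈ Icc (0 : ℝ) 1, |z₂ x| ≤ K * k
  htrunc : ∀ x ∈ Icc (0 : ℝ) 1,
    |z x - 1 / 3 * z₂ x + k * (p₁ x + β * (q x * q₁ x) + γ * (p x * p₁ x))| ≤ K * k ^ 2
  hθ : θ ∈ S N
  hξ : ξ ∈ S0 N
  hε : ε ∈ S0 N
  hθ1 : ∀ x ∈ Icc (0 : ℝ) 1, |θ x| ≤ 1
  hξ1 : ∀ x ∈ Icc (0 : ℝ) 1, |ξ x| ≤ 1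
  heq : ∀ χ ∈ S0 N, a (interp N z + ε) χ + k * ip (deriv (interp N p + θ)) χ
      + k * β * ip ((interp N q + ξ) * deriv (interp N q + ξ)) χ
      + k * γ * ip ((interp N p + θ) * deriv (interp N p + θ)) χ = 0

section MomentumStep

lemma normL2_interp_add_sub_le {N : ℕ} (hN : 0 < N) {K : ℝ} {p p₁ p₂ p₃ θ m : ℝ → ℝ}
    (hp : HasBddDerivs K p p₁ p₂ p₃) (hθ : θ ∈ S N) (hm : EssBdd m) {c : ℝ} (hc : 0 ≤ c)
    (hmc : ∀ x ∈ Icc (0 : ℝ) 1, |m x| ≤ c) :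
    normL2 (m * (interp N p + θ - p)) ≤ c * (normL2 θ + K / N ^ 2) := by
  have PIp := S.pwC1 hN (interp_mem N p)
  have Pθ := S.pwC1 hN hθ
  have Pp := hp.pwC1
  have hK : 0 ≤ K := (abs_nonneg _).trans (hp.b0 0 (by simp))
  refine (normL2_mul_le hm ((PIp.add Pθ).sub Pp).essBdd hc (ae_of_Icc hmc)).trans
    (mul_le_mul_of_nonneg_left ?_ hc)
  rw [show interp N p + θ - p = θ + (interp N p - p) by ring]
  refine (normL2_add_le Pθ.essBdd (PIp.sub Pp).essBdd).trans (add_le_add le_rfl ?_)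
  exact normL2_le_of_bound (PIp.sub Pp).essBdd (by positivity)
    (ae_of_Icc fun x hx => hp.interp_error hp.b2 hN hx)

variable {N : ℕ} {K β γ k : ℝ} {p p₁ p₂ p₃ q q₁ q₂ q₃ z z₁ z₂ θ ξ ε : ℝ → ℝ}

/-- The increment of the momentum error. There is no negative power of `h`, because the mass matrix
of the momentum balance controls first derivatives. -/
lemma MomentumStep.normH1_incr_le
    (h : MomentumStep N K β γ k p p₁ p₂ p₃ q q₁ q₂ q₃ z z₁ z₂ θ ξ ε) :
    normH1 ε ≤ 32 * K ^ 3 * k * (normL2 θ + normH1 ξ + (k + √N / N ^ 2)) := by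
  have hN := h.hN
  have hN' : (0 : ℝ) < N := by exact_mod_cast hN
  have hN1 : (1 : ℝ) ≤ N := by exact_mod_cast hN
  have hK := h.hK
  have hk := h.hk
  have PIp := S.pwC1 hN (interp_mem N p)
  have PIq := S.pwC1 hN (interp_mem N q)
  have PIz := S.pwC1 hN (interp_mem N z)
  have Pθ := S.pwC1 hN h.hθ
  have Pξ := S.pwC1 hN h.hξ.1
  have Pε := S.pwC1 hN h.hε.1
  have Pp := h.hp.pwC1
  have Pq := h.hq.pwC1
  have PH := PIp.add Pθ
  have PU := PIq.add Pξ
  have hX := normL2_nonneg θ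
  have hX' := normL2_nonneg ξ
  have hY := normH1_nonneg ξ
  have hE := normH1_nonneg ε
  have hsq : 1 / (N : ℝ) ^ 2 ≤ √N / N ^ 2 :=
    div_le_div_of_nonneg_right (Real.one_le_sqrt.2 hN1) (by positivity)
  have e := momentum_error_eq hN h.hp.toHasDerivs h.hq.toHasDerivs h.hz h.hz2 h.hθ h.hξ h.hε h.hε
    (h.heq ε h.hε)
  have Pm1 : PwC1 (1 + (γ / 2) • (interp N p + θ + p)) := PwC1.one.add ((PH.add Pp).smul _)
  have Pm2 : PwC1 ((β / 2) • (interp N q + ξ + q)) := (PU.add Pq).smul _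
  have sum_bound : ∀ {p p₁ p₂ p₃ θ : ℝ → ℝ}, HasBddDerivs K p p₁ p₂ p₃ →
      (∀ x ∈ Icc (0 : ℝ) 1, |θ x| ≤ 1) → ∀ x ∈ Icc (0 : ℝ) 1,
      |interp N p x + θ x + p x| ≤ 4 * K := fun hp hθ x hx => by
    refine (abs_add_three _ _ _).trans ?_
    have := hp.interp_bound hN hp.b0 hp.b2 hx
    have := hθ x hx
    have := hp.b0 x hx
    linarith
  have coef_bound : ∀ {c t : ℝ}, |c| ≤ K → |t| ≤ 4 * K → |c / 2 * t| ≤ 2 * K ^ 2 :=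
    fun {c t} hc ht => by
      rw [abs_mul, abs_div, abs_two]
      have := mul_le_mul hc ht (abs_nonneg _) (by linarith)
      linarith
  have b1 := normL2_interp_add_sub_le hN h.hp h.hθ Pm1.essBdd (c := 3 * K ^ 2) (by positivity)
    fun x hx => by
      have := coef_bound h.hγ (sum_bound h.hp h.hθ1 x hx)
      refine (abs_add_le _ _).trans ?_
      rw [Pi.one_apply, abs_one]
      refine (add_le_add le_rfl this).trans ?_
      nlinarith
  have b2 := normL2_interp_add_sub_le hN h.hq h.hξ.1 Pm2.essBdd (c := 2 * K ^ 2) (by positivity)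
    fun x hx => coef_bound h.hβ (sum_bound h.hq h.hξ1 x hx)
  rw [smul_mul_assoc] at b2
  have PG := (Pm1.mul (PH.sub Pp)).add (((PU.add Pq).mul (PU.sub Pq)).smul (β / 2))
  have b3 := (abs_ip_le PG.essBdd Pε.essBdd_deriv).trans
    (mul_le_mul ((normL2_add_le (Pm1.mul (PH.sub Pp)).essBdd
      (((PU.add Pq).mul (PU.sub Pq)).smul (β / 2)).essBdd).trans (add_le_add b1 b2))
      (normL2_deriv_le_normH1 ε) (normL2_nonneg _) (by positivity))
  have Bz2 : EssBdd z₂ := (PwC1.of_hasDerivWithinAt h.hz.d1 h.hz2).essBdd_deriv.congr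
    (deriv_ae_eq_of_hasDerivWithinAt h.hz.d1)
  have Bp1 : EssBdd p₁ := Pp.essBdd_deriv.congr (deriv_ae_eq_of_hasDerivWithinAt h.hp.d0)
  have Bq1 : EssBdd q₁ := Pq.essBdd_deriv.congr (deriv_ae_eq_of_hasDerivWithinAt h.hq.d0)
  have Bσ : EssBdd (interp N z - (1 / 3 : ℝ) • z₂ + k • (p₁ + β • (q * q₁) + γ • (p * p₁))) :=
    (PIz.essBdd.sub (Bz2.smul _)).add (((Bp1.add ((Pq.essBdd.mul Bq1).smul β)).add
      ((Pp.essBdd.mul Bp1).smul γ)).smul k)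
  have b4 : |ip (interp N z - (1 / 3 : ℝ) • z₂ + k • (p₁ + β • (q * q₁) + γ • (p * p₁))) ε|
      ≤ K * k * (k + √N / N ^ 2) * normH1 ε := by
    refine (abs_ip_le Bσ Pε.essBdd).trans ?_
    refine mul_le_mul ?_ (normL2_le_normH1 ε) (normL2_nonneg _) (by positivity)
    refine normL2_le_of_bound Bσ (by positivity) (ae_of_Icc fun x hx => ?_)
    have i1 := h.hz.interp_error h.hz2 hN hx
    have i2 := h.htrunc x hx
    have i3 := abs_add_le (interp N z x - z x)
      (z x - 1 / 3 * z₂ x + k * (p₁ x + β * (q x * q₁ x) + γ * (p x * p₁ x)))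
    have i4 : K * k / (N : ℝ) ^ 2 ≤ K * k * (√N / N ^ 2) := by
      rw [div_eq_mul_one_div]
      gcongr
    simp only [Pi.add_apply, Pi.mul_apply, Pi.smul_apply, Pi.sub_apply, smul_eq_mul]
    rw [show interp N z x - 1 / 3 * z₂ x + k * (p₁ x + β * (q x * q₁ x) + γ * (p x * p₁ x))
      = (interp N z x - z x)
        + (z x - 1 / 3 * z₂ x + k * (p₁ x + β * (q x * q₁ x) + γ * (p x * p₁ x))) by ring]
    nlinarith
  have b5 : normH1 ε ^ 2
      ≤ 32 * K ^ 3 * k * (normL2 θ + normH1 ξ + (k + √N / N ^ 2)) * normH1 ε := by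
    rw [normH1_sq, e]
    refine (le_abs_self _).trans ((abs_sub _ _).trans ?_)
    rw [abs_mul, abs_of_nonneg hk]
    refine (add_le_add (mul_le_mul_of_nonneg_left b3 hk) b4).trans ?_
    have hY' := normL2_le_normH1 ξ
    have s1 : K / (N : ℝ) ^ 2 ≤ K * (√N / N ^ 2) := by
      rw [div_eq_mul_one_div]
      gcongr
    set R := √N / (N : ℝ) ^ 2 with hR
    have hR0 : 0 ≤ R := by positivity
    have s2 : 3 * K ^ 2 * (normL2 θ + K / N ^ 2) + 2 * K ^ 2 * (normL2 ξ + K / N ^ 2)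
        ≤ 5 * K ^ 3 * (normL2 θ + normH1 ξ + (k + R)) := by
      have t1 : 3 * K ^ 2 * (normL2 θ + K / N ^ 2) ≤ 3 * K ^ 2 * (normL2 θ + K * R) := by gcongr
      have t2 : 2 * K ^ 2 * (normL2 ξ + K / N ^ 2) ≤ 2 * K ^ 2 * (normH1 ξ + K * R) := by gcongr
      have t3 : K ^ 2 * normL2 θ ≤ K ^ 3 * normL2 θ := by gcongr <;> linarith
      have t4 : K ^ 2 * normH1 ξ ≤ K ^ 3 * normH1 ξ := by gcongr <;> linarith
      have t5 : 0 ≤ K ^ 3 * k := by positivity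
      have t6 : 0 ≤ K ^ 3 * normH1 ξ := by positivity
      have t7 : 0 ≤ K ^ 3 * normL2 θ := by positivity
      nlinarith
    have s3 : K * k * (k + R) ≤ 5 * K ^ 3 * k * (normL2 θ + normH1 ξ + (k + R)) := by
      have t1 : K ≤ 5 * K ^ 3 := by nlinarith [pow_two_nonneg K, mul_self_nonneg (K - 1)]
      exact mul_le_mul (by gcongr) (by linarith) (by positivity) (by positivity)
    have s4 := mul_le_mul_of_nonneg_right (mul_le_mul_of_nonneg_left s2 hk)
      (by positivity : 0 ≤ 2 * normH1 ε)
    have s5 := mul_le_mul_of_nonneg_right s3 hE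
    have s6 : 0 ≤ K ^ 3 * k * (normL2 θ + normH1 ξ + (k + R)) * normH1 ε := by positivity
    nlinarith
  rcases hE.eq_or_lt with h0 | h0
  · rw [← h0]
    positivity
  · rw [pow_two] at b5
    exact le_of_mul_le_mul_right b5 h0

end MomentumStep

/-! ### Regularity of the exact solution -/

section Regularity

variable {T : ℝ} {f : ℝ → ℝ → ℝ} {n : WithTop ℕ∞}

lemma contDiffOn_slice_x {t : ℝ}
    (hf : ContDiffOn ℝ n (fun p : ℝ × ℝ => f p.1 p.2) (Icc 0 1 ×ˢ Icc 0 T)) (ht : t ∈ Icc 0 T) :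
    ContDiffOn ℝ n (fun x => f x t) (Icc 0 1) :=
  ContDiffOn.comp (g := fun p : ℝ × ℝ => f p.1 p.2) (f := fun x : ℝ => (x, t)) hf
    (by fun_prop) fun _ hx => ⟨hx, ht⟩

lemma contDiffOn_slice_t {x : ℝ}
    (hf : ContDiffOn ℝ n (fun p : ℝ × ℝ => f p.1 p.2) (Icc 0 1 ×ˢ Icc 0 T))
    (hx : x ∈ Icc (0 : ℝ) 1) : ContDiffOn ℝ n (fun t => f x t) (Icc 0 T) :=
  ContDiffOn.comp (g := fun p : ℝ × ℝ => f p.1 p.2) (f := fun t : ℝ => (x, t)) hf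
    (by fun_prop) fun _ ht => ⟨hx, ht⟩

lemma hasDerivWithinAt_dx {x t : ℝ} (hn : n ≠ 0)
    (hf : ContDiffOn ℝ n (fun p : ℝ × ℝ => f p.1 p.2) (Icc 0 1 ×ˢ Icc 0 T))
    (hx : x ∈ Icc (0 : ℝ) 1) (ht : t ∈ Icc 0 T) :
    HasDerivWithinAt (fun y => f y t) (dx f x t) (Icc 0 1) x :=
  ((contDiffOn_slice_x hf ht).differentiableOn hn x hx).hasDerivWithinAt

lemma hasDerivWithinAt_dt {x t : ℝ} (hn : n ≠ 0)
    (hf : ContDiffOn ℝ n (fun p : ℝ × ℝ => f p.1 p.2) (Icc 0 1 ×ˢ Icc 0 T))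
    (hx : x ∈ Icc (0 : ℝ) 1) (ht : t ∈ Icc 0 T) :
    HasDerivWithinAt (fun s => f x s) (dt T f x t) (Icc 0 T) t :=
  ((contDiffOn_slice_t hf hx).differentiableOn hn t ht).hasDerivWithinAt

lemma uniqueDiffOn_rect (hT : 0 < T) : UniqueDiffOn ℝ (Icc (0 : ℝ) 1 ×ˢ Icc 0 T) :=
  (uniqueDiffOn_Icc zero_lt_one).prod (uniqueDiffOn_Icc hT)

lemma contDiffOn_dx (hT : 0 < T) {m : WithTop ℕ∞} (hmn : m + 1 ≤ n)
    (hf : ContDiffOn ℝ n (fun p : ℝ × ℝ => f p.1 p.2) (Icc 0 1 ×ˢ Icc 0 T)) :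
    ContDiffOn ℝ m (fun p : ℝ × ℝ => dx f p.1 p.2) (Icc 0 1 ×ˢ Icc 0 T) := by
  have hn : n ≠ 0 := by
    rintro rfl
    simp at hmn
  refine ((hf.fderivWithin (uniqueDiffOn_rect hT) hmn).clm_apply
    (contDiffOn_const (c := ((1 : ℝ), (0 : ℝ))))).congr ?_
  rintro ⟨x, t⟩ ⟨hx, ht⟩
  have h := ((hf.differentiableOn hn (x, t) ⟨hx, ht⟩).hasFDerivWithinAt).comp_hasDerivWithinAt x
    (f := fun y : ℝ => (y, t)) (s := Icc 0 1)
    ((hasDerivWithinAt_id x _).prodMk (hasDerivWithinAt_const x _ t)) fun y hy => ⟨hy, ht⟩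
  exact h.derivWithin (uniqueDiffOn_Icc zero_lt_one x hx)

lemma contDiffOn_dt (hT : 0 < T) {m : WithTop ℕ∞} (hmn : m + 1 ≤ n)
    (hf : ContDiffOn ℝ n (fun p : ℝ × ℝ => f p.1 p.2) (Icc 0 1 ×ˢ Icc 0 T)) :
    ContDiffOn ℝ m (fun p : ℝ × ℝ => dt T f p.1 p.2) (Icc 0 1 ×ˢ Icc 0 T) := by
  have hn : n ≠ 0 := by
    rintro rfl
    simp at hmn
  refine ((hf.fderivWithin (uniqueDiffOn_rect hT) hmn).clm_apply
    (contDiffOn_const (c := ((0 : ℝ), (1 : ℝ))))).congr ?_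
  rintro ⟨x, t⟩ ⟨hx, ht⟩
  have h := ((hf.differentiableOn hn (x, t) ⟨hx, ht⟩).hasFDerivWithinAt).comp_hasDerivWithinAt t
    (f := fun s : ℝ => (x, s)) (s := Icc 0 T)
    ((hasDerivWithinAt_const t _ x).prodMk (hasDerivWithinAt_id t _)) fun y hy => ⟨hx, hy⟩
  exact h.derivWithin (uniqueDiffOn_Icc hT t ht)

lemma exists_bound_rect
    (hf : ContDiffOn ℝ n (fun p : ℝ × ℝ => f p.1 p.2) (Icc 0 1 ×ˢ Icc 0 T)) :
    ∃ K : ℝ, 0 ≤ K ∧ ∀ x ∈ Icc (0 : ℝ) 1, ∀ t ∈ Icc 0 T, |f x t| ≤ K := by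
  obtain ⟨K, hK⟩ := (isCompact_Icc.prod isCompact_Icc).exists_bound_of_continuousOn hf.continuousOn
  exact ⟨max K 0, le_max_right _ _, fun x hx t ht => (hK (x, t) ⟨hx, ht⟩).trans (le_max_left _ _)⟩

lemma HasBddDerivs.mono {K L : ℝ} {g g₁ g₂ g₃ : ℝ → ℝ} (h : HasBddDerivs K g g₁ g₂ g₃)
    (hKL : K ≤ L) : HasBddDerivs L g g₁ g₂ g₃ :=
  { h with
    b0 := fun x hx => (h.b0 x hx).trans hKL
    b1 := fun x hx => (h.b1 x hx).trans hKL
    b2 := fun x hx => (h.b2 x hx).trans hKL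
    b3 := fun x hx => (h.b3 x hx).trans hKL }

lemma exists_hasBddDerivs (hT : 0 < T)
    (hf : ContDiffOn ℝ 3 (fun p : ℝ × ℝ => f p.1 p.2) (Icc 0 1 ×ˢ Icc 0 T)) :
    ∃ K : ℝ, 0 ≤ K ∧ ∀ t ∈ Icc 0 T, HasBddDerivs K (fun x => f x t) (fun x => dx f x t)
      (fun x => dx (dx f) x t) (fun x => dx (dx (dx f)) x t) := by
  have h1 : ContDiffOn ℝ 2 (fun p : ℝ × ℝ => dx f p.1 p.2) (Icc 0 1 ×ˢ Icc 0 T) :=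
    contDiffOn_dx hT (by norm_num) hf
  have h2 : ContDiffOn ℝ 1 (fun p : ℝ × ℝ => dx (dx f) p.1 p.2) (Icc 0 1 ×ˢ Icc 0 T) :=
    contDiffOn_dx hT (by norm_num) h1
  have h3 : ContDiffOn ℝ 0 (fun p : ℝ × ℝ => dx (dx (dx f)) p.1 p.2) (Icc 0 1 ×ˢ Icc 0 T) :=
    contDiffOn_dx hT (by norm_num) h2
  obtain ⟨K0, p0, b0⟩ := exists_bound_rect hf
  obtain ⟨K1, p1, b1⟩ := exists_bound_rect h1
  obtain ⟨K2, p2, b2⟩ := exists_bound_rect h2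
  obtain ⟨K3, p3, b3⟩ := exists_bound_rect h3
  refine ⟨K0 + K1 + K2 + K3, by positivity, fun t ht => ⟨⟨fun x hx => ?_, fun x hx => ?_⟩,
    fun x hx => ?_, fun x hx => ?_, fun x hx => ?_, fun x hx => ?_, fun x hx => ?_⟩⟩
  · exact hasDerivWithinAt_dx (by norm_num) hf hx ht
  · exact hasDerivWithinAt_dx (by norm_num) h1 hx ht
  · exact hasDerivWithinAt_dx (by norm_num) h2 hx ht
  · linarith [b0 x hx t ht]
  · linarith [b1 x hx t ht]
  · linarith [b2 x hx t ht]
  · linarith [b3 x hx t ht]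

lemma abs_sub_le_of_time_deriv {ψ ψ₁ : ℝ → ℝ} {K s t : ℝ}
    (h : ∀ τ ∈ Icc 0 T, HasDerivWithinAt ψ (ψ₁ τ) (Icc 0 T) τ) (hK : ∀ τ ∈ Icc 0 T, |ψ₁ τ| ≤ K)
    (ht : t ∈ Icc 0 T) (hs : s ∈ Icc 0 T) (hts : t ≤ s) : |ψ s - ψ t| ≤ K * (s - t) := by
  have := (convex_Icc 0 T).norm_image_sub_le_of_norm_hasDerivWithin_le h hK ht hs
  rwa [Real.norm_eq_abs, Real.norm_eq_abs, abs_of_nonneg (sub_nonneg.2 hts)] at this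

/-- The truncation error of Euler's method. -/
lemma abs_taylor_le {ψ ψ₁ ψ₂ : ℝ → ℝ} {K s t : ℝ}
    (h : ∀ τ ∈ Icc 0 T, HasDerivWithinAt ψ (ψ₁ τ) (Icc 0 T) τ)
    (h' : ∀ τ ∈ Icc 0 T, HasDerivWithinAt ψ₁ (ψ₂ τ) (Icc 0 T) τ)
    (hK : ∀ τ ∈ Icc 0 T, |ψ₂ τ| ≤ K) (ht : t ∈ Icc 0 T) (hs : s ∈ Icc 0 T) (hts : t ≤ s) :
    |ψ s - ψ t - (s - t) * ψ₁ t| ≤ K * (s - t) ^ 2 := by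
  have hK0 : 0 ≤ K := (abs_nonneg _).trans (hK t ht)
  have hsub : Icc t s ⊆ Icc 0 T := Icc_subset_Icc ht.1 hs.2
  have hd : ∀ τ ∈ Icc t s, HasDerivWithinAt (fun τ => ψ τ - τ * ψ₁ t) (ψ₁ τ - ψ₁ t) (Icc t s) τ :=
    fun τ hτ => by
      have := ((h τ (hsub hτ)).mono hsub).sub
        ((hasDerivWithinAt_id τ (Icc t s)).mul_const (ψ₁ t))
      rw [one_mul] at this
      exact this
  have hb : ∀ τ ∈ Icc t s, ‖ψ₁ τ - ψ₁ t‖ ≤ K * (s - t) := fun τ hτ =>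
    (abs_sub_le_of_time_deriv h' hK ht (hsub hτ) hτ.1).trans
      (mul_le_mul_of_nonneg_left (by linarith [hτ.2]) hK0)
  have := (convex_Icc t s).norm_image_sub_le_of_norm_hasDerivWithin_le hd hb
    (left_mem_Icc.2 hts) (right_mem_Icc.2 hts)
  rw [Real.norm_eq_abs, Real.norm_eq_abs, abs_of_nonneg (sub_nonneg.2 hts)] at this
  calc |ψ s - ψ t - (s - t) * ψ₁ t| = |ψ s - s * ψ₁ t - (ψ t - t * ψ₁ t)| := by
        congr 1
        ring
    _ ≤ _ := this.trans (le_of_eq (by ring))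

end Regularity

/-- A classical solution of the system with flux `(1 + α η) u` in the mass balance and
`η + β u² / 2 + γ η² / 2` in the momentum balance. The parameters `(1, 1, 0)` give (CB), and
`(1/2, 3/2, 1/2)` give (SCB). -/
structure IsSolution (α β γ T : ℝ) (η₀ u₀ : ℝ → ℝ) (η u : ℝ → ℝ → ℝ) : Prop where
  mass : ∀ x ∈ Icc (0 : ℝ) 1, ∀ t ∈ Icc 0 T,
    dt T η x t + dx u x t + α * dx (fun y s => η y s * u y s) x t = 0
  momentum : ∀ x ∈ Icc (0 : ℝ) 1, ∀ t ∈ Icc 0 T,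
    dt T u x t + dx η x t + β * (u x t * dx u x t) + γ * (η x t * dx η x t)
      - (1 / 3) * dt T (dx (dx u)) x t = 0
  init_η : ∀ x ∈ Icc (0 : ℝ) 1, η x 0 = η₀ x
  init_u : ∀ x ∈ Icc (0 : ℝ) 1, u x 0 = u₀ x
  bdry_left : ∀ t ∈ Icc 0 T, u 0 t = 0
  bdry_right : ∀ t ∈ Icc 0 T, u 1 t = 0

lemma IsSolutionCB.isSolution {T : ℝ} {η₀ u₀ : ℝ → ℝ} {η u : ℝ → ℝ → ℝ}
    (h : IsSolutionCB T η₀ u₀ η u) : IsSolution 1 1 0 T η₀ u₀ η u :=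
  { h with
    mass := fun x hx t ht => by linarith [h.mass x hx t ht]
    momentum := fun x hx t ht => by linarith [h.momentum x hx t ht] }

lemma IsSolutionSCB.isSolution {T : ℝ} {η₀ u₀ : ℝ → ℝ} {η u : ℝ → ℝ → ℝ}
    (h : IsSolutionSCB T η₀ u₀ η u) : IsSolution (1 / 2) (3 / 2) (1 / 2) T η₀ u₀ η u :=
  { h with }

/-- The facts about the exact solution which enter the error analysis, with one constant `K`. The
truncation error in time of the momentum balance is stated for `u - u_xx / 3` as a whole: its time
derivative is a polynomial in first derivatives in space by the equation, so that it has a bounded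
second time derivative, although `u` has only three derivatives. -/
structure ErrorData (K α β γ T : ℝ) (η u : ℝ → ℝ → ℝ) : Prop where
  hK : 2 ≤ K
  hα : |α| ≤ K
  hβ : |β| ≤ K
  hγ : |γ| ≤ K
  flux : ∀ t ∈ Icc 0 T, HasBddDerivs K (fun x => 1 + α * η x t)
    (fun x => dx (fun y s => 1 + α * η y s) x t) (fun x => dx (dx (fun y s => 1 + α * η y s)) x t)
    (fun x => dx (dx (dx (fun y s => 1 + α * η y s))) x t)
  eta : ∀ t ∈ Icc 0 T, HasBddDerivs K (fun x => η x t) (fun x => dx η x t)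
    (fun x => dx (dx η) x t) (fun x => dx (dx (dx η)) x t)
  vel : ∀ t ∈ Icc 0 T, HasBddDerivs K (fun x => u x t) (fun x => dx u x t)
    (fun x => dx (dx u) x t) (fun x => dx (dx (dx u)) x t)
  bdry_left : ∀ t ∈ Icc 0 T, u 0 t = 0
  bdry_right : ∀ t ∈ Icc 0 T, u 1 t = 0
  eta_xx : ∀ x ∈ Icc (0 : ℝ) 1, ∀ t ∈ Icc 0 T, ∀ s ∈ Icc 0 T, t ≤ s →
    |dx (dx η) x s - dx (dx η) x t| ≤ K * (s - t)
  vel_xx : ∀ x ∈ Icc (0 : ℝ) 1, ∀ t ∈ Icc 0 T, ∀ s ∈ Icc 0 T, t ≤ s →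
    |dx (dx u) x s - dx (dx u) x t| ≤ K * (s - t)
  mass : ∀ x ∈ Icc (0 : ℝ) 1, ∀ t ∈ Icc 0 T, ∀ s ∈ Icc 0 T, t ≤ s →
    |η x s - η x t + (s - t) * (dx (fun y s => 1 + α * η y s) x t * u x t
      + (1 + α * η x t) * dx u x t)| ≤ K * (s - t) ^ 2
  momentum : ∀ x ∈ Icc (0 : ℝ) 1, ∀ t ∈ Icc 0 T, ∀ s ∈ Icc 0 T, t ≤ s →
    |u x s - u x t - 1 / 3 * (dx (dx u) x s - dx (dx u) x t)
      + (s - t) * (dx η x t + β * (u x t * dx u x t) + γ * (η x t * dx η x t))| ≤ K * (s - t) ^ 2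

lemma IsSolution.exists_errorData {α β γ T : ℝ} {η₀ u₀ : ℝ → ℝ} {η u : ℝ → ℝ → ℝ} (hT : 0 < T)
    (hη : ContDiffOn ℝ 3 (fun p : ℝ × ℝ => η p.1 p.2) (Icc 0 1 ×ˢ Icc 0 T))
    (hu : ContDiffOn ℝ 3 (fun p : ℝ × ℝ => u p.1 p.2) (Icc 0 1 ×ˢ Icc 0 T))
    (h : IsSolution α β γ T η₀ u₀ η u) : ∃ K, ErrorData K α β γ T η u := by
  set f : ℝ → ℝ → ℝ := fun y s => 1 + α * η y s with hf_def
  have hf : ContDiffOn ℝ 3 (fun p : ℝ × ℝ => f p.1 p.2) (Icc 0 1 ×ˢ Icc 0 T) :=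
    contDiffOn_const.add (contDiffOn_const.mul hη)
  have h32 : (2 : WithTop ℕ∞) ≤ 3 := by norm_num
  have hη1 : ContDiffOn ℝ 2 (fun p : ℝ × ℝ => dx η p.1 p.2) (Icc 0 1 ×ˢ Icc 0 T) :=
    contDiffOn_dx hT (by norm_num) hη
  have hη2 : ContDiffOn ℝ 1 (fun p : ℝ × ℝ => dx (dx η) p.1 p.2) (Icc 0 1 ×ˢ Icc 0 T) :=
    contDiffOn_dx hT (by norm_num) hη1
  have hu1 : ContDiffOn ℝ 2 (fun p : ℝ × ℝ => dx u p.1 p.2) (Icc 0 1 ×ˢ Icc 0 T) :=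
    contDiffOn_dx hT (by norm_num) hu
  have hu2 : ContDiffOn ℝ 1 (fun p : ℝ × ℝ => dx (dx u) p.1 p.2) (Icc 0 1 ×ˢ Icc 0 T) :=
    contDiffOn_dx hT (by norm_num) hu1
  have hf1 : ContDiffOn ℝ 2 (fun p : ℝ × ℝ => dx f p.1 p.2) (Icc 0 1 ×ˢ Icc 0 T) :=
    contDiffOn_dx hT (by norm_num) hf
  set Fx : ℝ → ℝ → ℝ := fun x t => dx f x t * u x t + f x t * dx u x t with hFx
  have hF : ContDiffOn ℝ 2 (fun p : ℝ × ℝ => Fx p.1 p.2) (Icc 0 1 ×ˢ Icc 0 T) :=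
    (hf1.mul (hu.of_le h32)).add ((hf.of_le h32).mul hu1)
  set Gx : ℝ → ℝ → ℝ := fun x t => dx η x t + β * (u x t * dx u x t) + γ * (η x t * dx η x t)
    with hGx
  have hG : ContDiffOn ℝ 2 (fun p : ℝ × ℝ => Gx p.1 p.2) (Icc 0 1 ×ˢ Icc 0 T) :=
    (hη1.add (contDiffOn_const.mul ((hu.of_le h32).mul hu1))).add
      (contDiffOn_const.mul ((hη.of_le h32).mul hη1))
  obtain ⟨K1, p1, b1⟩ := exists_hasBddDerivs hT hf
  obtain ⟨K2, p2, b2⟩ := exists_hasBddDerivs hT hη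
  obtain ⟨K3, p3, b3⟩ := exists_hasBddDerivs hT hu
  obtain ⟨K4, p4, b4⟩ := exists_bound_rect (contDiffOn_dt (m := 0) hT (by norm_num) hη2)
  obtain ⟨K5, p5, b5⟩ := exists_bound_rect (contDiffOn_dt (m := 0) hT (by norm_num) hu2)
  obtain ⟨K6, p6, b6⟩ := exists_bound_rect (contDiffOn_dt (m := 1) hT (by norm_num) hF)
  obtain ⟨K7, p7, b7⟩ := exists_bound_rect (contDiffOn_dt (m := 1) hT (by norm_num) hG)
  have pα := abs_nonneg α
  have pβ := abs_nonneg β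
  have pγ := abs_nonneg γ
  have dη : ∀ x ∈ Icc (0 : ℝ) 1, ∀ t ∈ Icc 0 T,
      HasDerivWithinAt (fun s => η x s) (-Fx x t) (Icc 0 T) t := fun x hx t ht => by
    refine (hasDerivWithinAt_dt (by norm_num) hη hx ht).congr_deriv ?_
    have e1 := hasDerivWithinAt_dx (by norm_num) hη hx ht
    have e2 := hasDerivWithinAt_dx (by norm_num) hu hx ht
    have e3 : dx (fun y s => η y s * u y s) x t = dx η x t * u x t + η x t * dx u x t :=
      (e1.mul e2).derivWithin (uniqueDiffOn_Icc zero_lt_one x hx)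
    have e4 : dx f x t = α * dx η x t :=
      ((e1.const_mul α).const_add 1).derivWithin (uniqueDiffOn_Icc zero_lt_one x hx)
    have := h.mass x hx t ht
    rw [e3] at this
    simp only [hFx]
    rw [e4, show f x t = 1 + α * η x t from rfl]
    linarith
  have dw : ∀ x ∈ Icc (0 : ℝ) 1, ∀ t ∈ Icc 0 T,
      HasDerivWithinAt (fun s => u x s - 1 / 3 * dx (dx u) x s) (-Gx x t) (Icc 0 T) t :=
    fun x hx t ht => by
      refine ((hasDerivWithinAt_dt (by norm_num) hu hx ht).sub
        ((hasDerivWithinAt_dt (by norm_num) hu2 hx ht).const_mul (1 / 3))).congr_deriv ?_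
      have := h.momentum x hx t ht
      simp only [hGx]
      linarith
  refine ⟨2 + |α| + |β| + |γ| + K1 + K2 + K3 + K4 + K5 + K6 + K7, by linarith, by linarith,
    by linarith, by linarith, fun t ht => (b1 t ht).mono (by linarith),
    fun t ht => (b2 t ht).mono (by linarith), fun t ht => (b3 t ht).mono (by linarith),
    h.bdry_left, h.bdry_right, fun x hx t ht s hs hts => ?_, fun x hx t ht s hs hts => ?_,
    fun x hx t ht s hs hts => ?_, fun x hx t ht s hs hts => ?_⟩
  · refine (abs_sub_le_of_time_deriv (fun τ hτ => hasDerivWithinAt_dt (by norm_num) hη2 hx hτ)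
      (fun τ hτ => b4 x hx τ hτ) ht hs hts).trans ?_
    exact mul_le_mul_of_nonneg_right (by linarith) (sub_nonneg.2 hts)
  · refine (abs_sub_le_of_time_deriv (fun τ hτ => hasDerivWithinAt_dt (by norm_num) hu2 hx hτ)
      (fun τ hτ => b5 x hx τ hτ) ht hs hts).trans ?_
    exact mul_le_mul_of_nonneg_right (by linarith) (sub_nonneg.2 hts)
  · have := abs_taylor_le (dη x hx)
      (fun τ hτ => (hasDerivWithinAt_dt (by norm_num) hF hx hτ).neg)
      (fun τ hτ => (abs_neg _).trans_le (b6 x hx τ hτ)) ht hs hts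
    rw [mul_neg, sub_neg_eq_add] at this
    exact this.trans (mul_le_mul_of_nonneg_right (by linarith) (sq_nonneg _))
  · have := abs_taylor_le (dw x hx)
      (fun τ hτ => (hasDerivWithinAt_dt (by norm_num) hG hx hτ).neg)
      (fun τ hτ => (abs_neg _).trans_le (b7 x hx τ hτ)) ht hs hts
    rw [mul_neg, sub_neg_eq_add] at this
    refine le_trans (le_of_eq ?_)
      (this.trans (mul_le_mul_of_nonneg_right (by linarith) (sq_nonneg _)))
    congr 1
    ring

/-! ### Accumulation of the errors and convergence -/

/-- The rate in the discrete Gronwall inequality. Its dependence on `μ = k / h²` comes from the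
explicit treatment of the transport term, which costs a factor `1 / h` per step. -/
def growthRate (c T μ : ℝ) : ℝ := 6 * c + c ^ 2 * (6 * T + 3 * μ)

/-- One step of the energy recursion, `X` and `Y` being the errors of the two components. -/
lemma energy_step {c k T μ N X Y X' Y' r : ℝ} (hc : 0 ≤ c) (hk : 0 ≤ k) (hkT : k ≤ T)
    (hμ : k * N ^ 2 = μ) (hY' : 0 ≤ Y')
    (h1 : X' ^ 2 ≤ X ^ 2 + 2 * (c * k * (X + Y + r) * X) + (c * k * (N * X + Y + r)) ^ 2)
    (h2 : Y' ≤ Y + c * k * (X + Y + r)) :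
    X' ^ 2 + Y' ^ 2 + r ^ 2 ≤ (1 + k * growthRate c T μ) * (X ^ 2 + Y ^ 2 + r ^ 2) := by
  have h3 : Y' ^ 2 ≤ (Y + c * k * (X + Y + r)) ^ 2 := pow_le_pow_left₀ hY' h2 2
  have sq3 : ∀ x y z : ℝ, (x + y + z) ^ 2 ≤ 3 * (x ^ 2 + y ^ 2 + z ^ 2) := fun x y z => by
    nlinarith [sq_nonneg (x - y), sq_nonneg (y - z), sq_nonneg (x - z)]
  have hck : 0 ≤ c * k := mul_nonneg hc hk
  have i1 : (X + Y + r) * (X + Y) ≤ 3 * (X ^ 2 + Y ^ 2 + r ^ 2) := by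
    nlinarith [sq_nonneg (X - Y), sq_nonneg (X - r), sq_nonneg (Y - r), sq_nonneg r]
  have i2 : (c * k * (N * X + Y + r)) ^ 2
      ≤ c ^ 2 * k * (3 * (μ * X ^ 2 + T * (Y ^ 2 + r ^ 2))) := by
    have : k * (N * X + Y + r) ^ 2 ≤ 3 * (μ * X ^ 2 + T * (Y ^ 2 + r ^ 2)) := by
      have e := mul_le_mul_of_nonneg_left (sq3 (N * X) Y r) hk
      have : k * (Y ^ 2 + r ^ 2) ≤ T * (Y ^ 2 + r ^ 2) := by gcongr
      rw [← hμ]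
      nlinarith
    have := mul_le_mul_of_nonneg_left this (by positivity : 0 ≤ c ^ 2 * k)
    linarith
  have i3 : (c * k * (X + Y + r)) ^ 2 ≤ c ^ 2 * k * (3 * (T * (X ^ 2 + Y ^ 2 + r ^ 2))) := by
    have : k * (X + Y + r) ^ 2 ≤ 3 * (T * (X ^ 2 + Y ^ 2 + r ^ 2)) := by
      have e := mul_le_mul_of_nonneg_left (sq3 X Y r) hk
      have : k * (X ^ 2 + Y ^ 2 + r ^ 2) ≤ T * (X ^ 2 + Y ^ 2 + r ^ 2) := by gcongr
      linarith
    have := mul_le_mul_of_nonneg_left this (by positivity : 0 ≤ c ^ 2 * k)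
    linarith
  have i4 := mul_le_mul_of_nonneg_left i1 hck
  have hT : 0 ≤ T := hk.trans hkT
  have hμ0 : 0 ≤ μ := by rw [← hμ]; positivity
  have i5 : 3 * (μ * X ^ 2 + T * (Y ^ 2 + r ^ 2)) + 3 * (T * (X ^ 2 + Y ^ 2 + r ^ 2))
      ≤ (6 * T + 3 * μ) * (X ^ 2 + Y ^ 2 + r ^ 2) := by
    have : 0 ≤ T * X ^ 2 := by positivity
    have : 0 ≤ μ * (Y ^ 2 + r ^ 2) := by positivity
    linarith
  have i6 := mul_le_mul_of_nonneg_left i5 (by positivity : 0 ≤ c ^ 2 * k)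
  rw [growthRate]
  linarith

/-- Discrete Gronwall inequality with bootstrap: the recursion is available only while the errors
satisfy a smallness condition, and the resulting bound guarantees that condition. -/
lemma energy_bound {c k T μ N r : ℝ} {M : ℕ} {X Y : ℕ → ℝ} (hc : 0 ≤ c) (hk : 0 ≤ k)
    (hkT : M * k = T) (hμ : k * N ^ 2 = μ) (hY : ∀ n, 0 ≤ Y n) (hr : 0 ≤ r)
    (hX0 : X 0 = 0) (hY0 : Y 0 = 0)
    (hstep : ∀ n < M, X n ≤ Real.exp (T * growthRate c T μ) * r →
      Y n ≤ Real.exp (T * growthRate c T μ) * r →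
      X (n + 1) ^ 2 ≤ X n ^ 2 + 2 * (c * k * (X n + Y n + r) * X n)
        + (c * k * (N * X n + Y n + r)) ^ 2 ∧
      Y (n + 1) ≤ Y n + c * k * (X n + Y n + r)) :
    ∀ n ≤ M, X n ≤ Real.exp (T * growthRate c T μ) * r ∧
      Y n ≤ Real.exp (T * growthRate c T μ) * r := by
  have hμ0 : 0 ≤ μ := by rw [← hμ]; positivity
  have hT : 0 ≤ T := by rw [← hkT]; positivity
  have hΛ : 0 ≤ growthRate c T μ := by unfold growthRate; positivity
  have concl : ∀ n ≤ M,
      X n ^ 2 + Y n ^ 2 + r ^ 2 ≤ (1 + k * growthRate c T μ) ^ n * r ^ 2 →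
      X n ≤ Real.exp (T * growthRate c T μ) * r ∧
      Y n ≤ Real.exp (T * growthRate c T μ) * r := fun n hn h => by
    have e1 : (1 + k * growthRate c T μ) ^ n ≤ Real.exp (T * growthRate c T μ) := by
      calc (1 + k * growthRate c T μ) ^ n ≤ Real.exp (k * growthRate c T μ) ^ n := by
            gcongr
            linarith [Real.add_one_le_exp (k * growthRate c T μ)]
        _ = Real.exp (n * (k * growthRate c T μ)) := (Real.exp_nat_mul _ _).symm
        _ ≤ _ := by
            rw [Real.exp_le_exp]
            calc n * (k * growthRate c T μ) ≤ M * (k * growthRate c T μ) := by gcongr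
              _ = T * growthRate c T μ := by rw [← mul_assoc, hkT]
    have e2 : 1 ≤ Real.exp (T * growthRate c T μ) := Real.one_le_exp (by positivity)
    set E := Real.exp (T * growthRate c T μ)
    have e3 : X n ^ 2 + Y n ^ 2 + r ^ 2 ≤ (E * r) ^ 2 := by
      refine h.trans ?_
      rw [mul_pow]
      gcongr
      nlinarith
    have e4 : 0 ≤ E * r := by positivity
    exact ⟨abs_le_of_sq_le_sq' (by nlinarith [sq_nonneg (Y n), sq_nonneg r]) e4 |>.2,
      abs_le_of_sq_le_sq' (by nlinarith [sq_nonneg (X n), sq_nonneg r]) e4 |>.2⟩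
  have main : ∀ n ≤ M, X n ^ 2 + Y n ^ 2 + r ^ 2 ≤ (1 + k * growthRate c T μ) ^ n * r ^ 2 := by
    intro n
    induction n with
    | zero => intro _; simp [hX0, hY0]
    | succ n ih =>
      intro hn
      have ih := ih (Nat.le_of_succ_le hn)
      obtain ⟨b1, b2⟩ := concl n (Nat.le_of_succ_le hn) ih
      obtain ⟨s1, s2⟩ := hstep n hn b1 b2
      have hkT' : k ≤ T := by
        have : (1 : ℝ) ≤ M := by exact_mod_cast (Nat.succ_pos n).trans_le hn
        nlinarith
      refine (energy_step hc hk hkT' hμ (hY _) s1 s2).trans ?_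
      rw [pow_succ' (1 + k * growthRate c T μ), mul_assoc]
      gcongr
  exact fun n hn => concl n hn (main n hn)

/-- The explicit Euler–Galerkin scheme for the system of `IsSolution`. -/
structure IsEuler (α β γ : ℝ) (N M : ℕ) (k : ℝ) (η₀ u₀ : ℝ → ℝ) (H U : ℕ → ℝ → ℝ) : Prop where
  H_mem : ∀ n ≤ M, H n ∈ S N
  U_mem : ∀ n ≤ M, U n ∈ S0 N
  init_H : AgreesAtNodes N (H 0) η₀
  init_U : AgreesAtNodes N (U 0) u₀
  step_H : ∀ n < M, ∀ φ ∈ S N,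
    ip (H (n + 1) - H n) φ + k * ip (deriv (U n)) φ + k * α * ip (deriv (H n * U n)) φ = 0
  step_U : ∀ n < M, ∀ χ ∈ S0 N,
    a (U (n + 1) - U n) χ + k * ip (deriv (H n)) χ + k * β * ip (U n * deriv (U n)) χ
      + k * γ * ip (H n * deriv (H n)) χ = 0

lemma IsEulerCB.isEuler {N M : ℕ} {k : ℝ} {η₀ u₀ : ℝ → ℝ} {H U : ℕ → ℝ → ℝ}
    (h : IsEulerCB N M k η₀ u₀ H U) : IsEuler 1 1 0 N M k η₀ u₀ H U :=
  { h with
    step_H := fun n hn φ hφ => by linarith [h.step_H n hn φ hφ]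
    step_U := fun n hn χ hχ => by linarith [h.step_U n hn χ hχ] }

lemma IsEulerSCB.isEuler {N M : ℕ} {k : ℝ} {η₀ u₀ : ℝ → ℝ} {H U : ℕ → ℝ → ℝ}
    (h : IsEulerSCB N M k η₀ u₀ H U) : IsEuler (1 / 2) (3 / 2) (1 / 2) N M k η₀ u₀ H U :=
  { h with
    step_H := fun n hn φ hφ => by linarith [h.step_H n hn φ hφ]
    step_U := fun n hn χ hχ => by linarith [h.step_U n hn χ hχ] }

lemma normL2_eq_zero_of_eqOn {f : ℝ → ℝ} (h : EqOn f 0 (Icc 0 1)) : normL2 f = 0 := by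
  rw [normL2_congr (g := 0) (ae_of_Icc h)]
  simp [normL2, ip]

/-- The discrete solution stays close to the interpolant of the exact one, provided that the bound
itself, multiplied by the constant `2 √N` of the inverse inequality, is at most one. -/
lemma IsEuler.interp_error_bound {α β γ T K : ℝ} {η₀ u₀ : ℝ → ℝ} {η u : ℝ → ℝ → ℝ}
    (hs : IsSolution α β γ T η₀ u₀ η u) (hd : ErrorData K α β γ T η u) {N M : ℕ} (hN : 0 < N)
    {k μ : ℝ} (hk : 0 ≤ k) (hkT : M * k = T) (hμ : k * (N : ℝ) ^ 2 = μ) {H U : ℕ → ℝ → ℝ}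
    (hE : IsEuler α β γ N M k η₀ u₀ H U)
    (hsmall : 2 * √N * (Real.exp (T * growthRate (32 * K ^ 3) T μ) * (k + √N / N ^ 2)) ≤ 1) :
    ∀ n ≤ M,
      normL2 (H n - interp N fun x => η x (n * k))
        ≤ Real.exp (T * growthRate (32 * K ^ 3) T μ) * (k + √N / N ^ 2) ∧
      normH1 (U n - interp N fun x => u x (n * k))
        ≤ Real.exp (T * growthRate (32 * K ^ 3) T μ) * (k + √N / N ^ 2) := by
  have hK := hd.hK
  have hT : 0 ≤ T := by rw [← hkT]; positivity
  have htime : ∀ n ≤ M, (n * k : ℝ) ∈ Icc 0 T := fun n hn =>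
    ⟨by positivity, by rw [← hkT]; gcongr⟩
  set p : ℕ → ℝ → ℝ := fun n x => η x (n * k) with hp
  set q : ℕ → ℝ → ℝ := fun n x => u x (n * k) with hq
  have hξ0 : ∀ n ≤ M, U n - interp N (q n) ∈ S0 N := fun n hn => by
    refine S0.sub (hE.U_mem n hn) ⟨interp_mem N _, ?_, ?_⟩
    · rw [interp_zero hN]
      exact hs.bdry_left _ (htime n hn)
    · rw [interp_one hN]
      exact hs.bdry_right _ (htime n hn)
  have hθ0 : ∀ n ≤ M, H n - interp N (p n) ∈ S N := fun n hn =>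
    S.sub (hE.H_mem n hn) (interp_mem N _)
  -- the scheme starts from the interpolants
  have init : ∀ {V : ℝ → ℝ} {w w₀ : ℝ → ℝ}, V ∈ S N → AgreesAtNodes N V w₀ →
      (∀ x ∈ Icc (0 : ℝ) 1, w x = w₀ x) → EqOn (V - interp N w) 0 (Icc 0 1) :=
    fun {V w w₀} hV hVw hw x hx => by
      have : AgreesAtNodes N V w := fun i hi => by
        rw [hVw i hi, hw]
        have hN' : (0 : ℝ) < N := by exact_mod_cast hN
        refine ⟨by positivity, ?_⟩
        rw [div_le_one hN']
        exact_mod_cast hi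
      simp [S.eqOn_interp hN hV this hx]
  have hH0 : EqOn (H 0 - interp N (p 0)) 0 (Icc 0 1) :=
    init (hE.H_mem 0 (Nat.zero_le M)) hE.init_H fun x hx => by simpa [hp] using hs.init_η x hx
  have hU0 : EqOn (U 0 - interp N (q 0)) 0 (Icc 0 1) :=
    init (hE.U_mem 0 (Nat.zero_le M)).1 hE.init_U fun x hx => by simpa [hq] using hs.init_u x hx
  refine energy_bound (N := N) (c := 32 * K ^ 3) (by positivity) hk hkT hμ
    (fun n => normH1_nonneg _) (by positivity)
    (normL2_eq_zero_of_eqOn hH0) ?_ fun n hn hXn hYn => ?_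
  · have h1 : normL2 (deriv (U 0 - interp N (q 0))) = 0 := by
      rw [normL2_congr (g := 0), normL2, ip]
      · simp
      · refine ae_of_Ioo fun x hx => ?_
        have : (U 0 - interp N (q 0)) =ᶠ[nhds x] 0 := by
          filter_upwards [Icc_mem_nhds hx.1 hx.2] with y hy using hU0 hy
        rw [this.deriv_eq]
        simp
    have h2 := normH1_le (U 0 - interp N (q 0))
    rw [normL2_eq_zero_of_eqOn hU0, h1, add_zero] at h2
    exact le_antisymm h2 (normH1_nonneg _)
  have ht := htime n hn.le
  have ht' := htime (n + 1) hn
  have htt : (n * k : ℝ) ≤ ((n + 1 : ℕ) : ℝ) * k := by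
    push_cast
    nlinarith
  have hdt : ((n + 1 : ℕ) : ℝ) * k - n * k = k := by
    push_cast
    ring
  have sup : ∀ {φ : ℝ → ℝ}, φ ∈ S N →
      normL2 φ ≤ Real.exp (T * growthRate (32 * K ^ 3) T μ) * (k + √N / N ^ 2) →
      ∀ x ∈ Icc (0 : ℝ) 1, |φ x| ≤ 1 := fun {φ} hφ hb x hx =>
    (S.abs_le hN hφ hx).trans ((mul_le_mul_of_nonneg_left hb (by positivity)).trans hsmall)
  have hθ1 := sup (hθ0 n hn.le) hXn
  have hξ1 := sup (hξ0 n hn.le).1 ((normL2_le_normH1 _).trans hYn)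
  have hIp : interp N (p n) + (H n - interp N (p n)) = H n := add_sub_cancel _ _
  have hIq : interp N (q n) + (U n - interp N (q n)) = U n := add_sub_cancel _ _
  have massStep : MassStep N K α k (p n) (fun x => 1 + α * η x (n * k)) _ _ _ (q n) _ _ _
      (p (n + 1) - p n) _ _ (H n - interp N (p n)) (U n - interp N (q n))
      ((H (n + 1) - interp N (p (n + 1))) - (H n - interp N (p n))) :=
    { hN := hN
      hK := hK
      hα := hd.hα
      hk := hk
      hf := hd.flux _ ht
      hfp := fun x => rfl
      hq := hd.vel _ ht
      hq0 := hd.bdry_left _ ht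
      hq1 := hd.bdry_right _ ht
      hv := (hd.eta _ ht').toHasDerivs.sub (hd.eta _ ht).toHasDerivs
      hv2 := fun x hx => by
        have := hd.eta_xx x hx _ ht _ ht' htt
        rwa [hdt] at this
      htrunc := fun x hx => by
        have := hd.mass x hx _ ht _ ht' htt
        rwa [hdt] at this
      hθ := hθ0 n hn.le
      hξ := hξ0 n hn.le
      hδ := S.sub (hθ0 (n + 1) hn) (hθ0 n hn.le)
      hθ1 := hθ1
      hξ1 := hξ1
      heq := fun φ hφ => by
        have e : interp N (p (n + 1) - p n)
            + (H (n + 1) - interp N (p (n + 1)) - (H n - interp N (p n))) = H (n + 1) - H n := by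
          rw [interp_sub]
          ring
        rw [hIp, hIq, e]
        exact hE.step_H n hn φ hφ }
  have momStep : MomentumStep N K β γ k (p n) _ _ _ (q n) _ _ _
      (q (n + 1) - q n) _ _ (H n - interp N (p n)) (U n - interp N (q n))
      ((U (n + 1) - interp N (q (n + 1))) - (U n - interp N (q n))) :=
    { hN := hN
      hK := hK
      hβ := hd.hβ
      hγ := hd.hγ
      hk := hk
      hp := hd.eta _ ht
      hq := hd.vel _ ht
      hz := (hd.vel _ ht').toHasDerivs.sub (hd.vel _ ht).toHasDerivs
      hz2 := fun x hx => by
        have := hd.vel_xx x hx _ ht _ ht' htt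
        rwa [hdt] at this
      htrunc := fun x hx => by
        have := hd.momentum x hx _ ht _ ht' htt
        rwa [hdt] at this
      hθ := hθ0 n hn.le
      hξ := hξ0 n hn.le
      hε := S0.sub (hξ0 (n + 1) hn) (hξ0 n hn.le)
      hθ1 := hθ1
      hξ1 := hξ1
      heq := fun χ hχ => by
        have e : interp N (q (n + 1) - q n)
            + (U (n + 1) - interp N (q (n + 1)) - (U n - interp N (q n))) = U (n + 1) - U n := by
          rw [interp_sub]
          ring
        rw [hIp, hIq, e]
        exact hE.step_U n hn χ hχ }
  have m1 := (abs_le.1 massStep.ip_self_le).2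
  have m2 := massStep.normL2_incr_le
  have m3 := momStep.normH1_incr_le
  have Bθ := (S.pwC1 hN (hθ0 n hn.le)).essBdd
  have Bθ' := (S.pwC1 hN (hθ0 (n + 1) hn)).essBdd
  have Pξ := S.pwC1 hN (hξ0 n hn.le).1
  have Pξ' := S.pwC1 hN (hξ0 (n + 1) hn).1
  set θ := H n - interp N (p n)
  set θ' := H (n + 1) - interp N (p (n + 1))
  set ξ := U n - interp N (q n)
  set ξ' := U (n + 1) - interp N (q (n + 1))
  have hX := normL2_nonneg θ
  have hY := normH1_nonneg ξ
  have hKK : K ^ 2 ≤ K ^ 3 := by gcongr <;> linarith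
  set R := k + √N / (N : ℝ) ^ 2
  have hR : 0 ≤ R := by positivity
  constructor
  · have Bδ := Bθ'.sub Bθ
    have e1 : normL2 θ' ^ 2 = normL2 θ ^ 2 + 2 * ip (θ' - θ) θ + normL2 (θ' - θ) ^ 2 := by
      rw [normL2_sq, normL2_sq, normL2_sq, ip_sub_left Bθ' Bθ Bθ, ip_sub_left Bθ' Bθ Bδ,
        ip_comm θ' (θ' - θ), ip_comm θ (θ' - θ), ip_sub_left Bθ' Bθ Bθ', ip_sub_left Bθ' Bθ Bθ,
        ip_comm θ θ']
      ring
    rw [e1]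
    have e2 : 32 * K ^ 2 * k * (normL2 θ + normH1 ξ + R) * normL2 θ
        ≤ 32 * K ^ 3 * k * (normL2 θ + normH1 ξ + R) * normL2 θ := by gcongr
    have e3 : normL2 (θ' - θ) ^ 2 ≤ (32 * K ^ 3 * k * (N * normL2 θ + normH1 ξ + R)) ^ 2 := by
      refine pow_le_pow_left₀ (normL2_nonneg _) (m2.trans ?_) 2
      gcongr
    linarith
  · have := normH1_add_le Pξ (Pξ'.sub Pξ)
    rw [add_sub_cancel] at this
    linarith

lemma normL2_sub_interp_le {f f₁ f₂ V : ℝ → ℝ} {K : ℝ} {N : ℕ} (hN : 0 < N)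
    (hf : HasDerivs f f₁ f₂) (hK : ∀ x ∈ Icc (0 : ℝ) 1, |f₂ x| ≤ K) (hV : V ∈ S N) :
    normL2 (V - f) ≤ normL2 (V - interp N f) + K / N ^ 2 := by
  have PI := S.pwC1 hN (interp_mem N f)
  have hK0 : 0 ≤ K := (abs_nonneg _).trans (hK 0 (by simp))
  rw [show V - f = (V - interp N f) + (interp N f - f) by ring]
  refine (normL2_add_le ((S.pwC1 hN hV).sub PI).essBdd (PI.sub hf.pwC1).essBdd).trans
    (add_le_add le_rfl ?_)
  exact normL2_le_of_bound (PI.sub hf.pwC1).essBdd (by positivity)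
    (ae_of_Icc fun x hx => hf.interp_error hK hN hx)

lemma normH1_sub_interp_le {f f₁ f₂ V : ℝ → ℝ} {K : ℝ} {N : ℕ} (hN : 0 < N)
    (hf : HasDerivs f f₁ f₂) (hK : ∀ x ∈ Icc (0 : ℝ) 1, |f₂ x| ≤ K) (hV : V ∈ S N) :
    normH1 (V - f) ≤ normH1 (V - interp N f) + 2 * K / N := by
  have hN1 : (1 : ℝ) ≤ N := by exact_mod_cast hN
  have PI := S.pwC1 hN (interp_mem N f)
  have hK0 : 0 ≤ K := (abs_nonneg _).trans (hK 0 (by simp))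
  have PE := PI.sub hf.pwC1
  rw [show V - f = (V - interp N f) + (interp N f - f) by ring]
  refine (normH1_add_le ((S.pwC1 hN hV).sub PI) PE).trans (add_le_add le_rfl ?_)
  have h1 : normL2 (interp N f - f) ≤ K / N := by
    refine (normL2_le_of_bound PE.essBdd (by positivity)
      (ae_of_Icc fun x hx => hf.interp_error hK hN hx)).trans ?_
    gcongr
    exact le_self_pow₀ hN1 two_ne_zero
  have h2 : normL2 (deriv (interp N f - f)) ≤ K / N := by
    refine normL2_le_of_bound PE.essBdd_deriv (by positivity) ?_
    filter_upwards [PI.deriv_sub_ae hf.pwC1, deriv_ae_eq_of_hasDerivWithinAt hf.d0,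
      hf.interp_deriv_error hK hN] with x i1 i2 i3
    rw [i1, Pi.sub_apply, i2]
    exact i3
  refine (normH1_le _).trans ((add_le_add h1 h2).trans (le_of_eq ?_))
  ring

/-- Convergence of the explicit Euler–Galerkin scheme for the whole family of systems. -/
theorem IsSolution.exists_error_bound {α β γ T : ℝ} {η₀ u₀ : ℝ → ℝ} {η u : ℝ → ℝ → ℝ} (hT : 0 < T)
    (hη : ContDiffOn ℝ 3 (fun p : ℝ × ℝ => η p.1 p.2) (Icc 0 1 ×ˢ Icc 0 T))
    (hu : ContDiffOn ℝ 3 (fun p : ℝ × ℝ => u p.1 p.2) (Icc 0 1 ×ˢ Icc 0 T))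
    (hs : IsSolution α β γ T η₀ u₀ η u) :
    ∃ C : ℝ → ℝ, ContinuousOn C (Ici 0) ∧ StrictMonoOn C (Ici 0) ∧
      ∀ μ₀ : ℝ, 0 < μ₀ → ∃ h₀ : ℝ, 0 < h₀ ∧
        ∀ (N M : ℕ) (h k : ℝ), 2 ≤ N → 1 ≤ M → h = 1 / N → k = T / M →
          h ≤ h₀ → k / h ^ 2 ≤ μ₀ →
          ∀ H U : ℕ → ℝ → ℝ, IsEuler α β γ N M k η₀ u₀ H U →
            ∀ n ≤ M,
              normL2 (fun x => H n x - η x (n * k)) ≤ C (k / h ^ 2) * (k + h ^ (3 / 2 : ℝ)) ∧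
              normH1 (fun x => U n x - u x (n * k)) ≤ C (k / h ^ 2) * (k + h) := by
  obtain ⟨K, hd⟩ := hs.exists_errorData hT hη hu
  have hK := hd.hK
  set E : ℝ → ℝ := fun μ => Real.exp (T * growthRate (32 * K ^ 3) T μ) with hE_def
  have hEmono : StrictMono E := fun x y hxy => by
    simp only [hE_def, growthRate, Real.exp_lt_exp]
    have : 0 < (32 * K ^ 3) ^ 2 := by positivity
    gcongr
  refine ⟨fun μ => E μ + 2 * K, ?_, fun x _ y _ hxy => ?_, fun μ₀ hμ₀ => ?_⟩
  · refine Continuous.continuousOn ?_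
    simp only [hE_def, growthRate]
    fun_prop
  · exact add_lt_add_left (hEmono hxy) _
  have hE0 : 0 < E μ₀ := Real.exp_pos _
  refine ⟨1 / (2 * E μ₀ * (μ₀ + 1)), by positivity, ?_⟩
  intro N M h k hN2 hM hh hkM hh0 hμ H U hE n hn
  have hN : 0 < N := by omega
  have hN' : (0 : ℝ) < N := by exact_mod_cast hN
  have hN1 : (1 : ℝ) ≤ N := by exact_mod_cast hN
  have hM' : (0 : ℝ) < M := by exact_mod_cast hM
  have hk : 0 ≤ k := by rw [hkM]; positivity
  have hkT : M * k = T := by rw [hkM]; field_simp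
  have hμ' : k * (N : ℝ) ^ 2 = k / h ^ 2 := by rw [hh]; field_simp
  have hsq : √(N : ℝ) * √N = N := Real.mul_self_sqrt hN'.le
  have hh32 : h ^ (3 / 2 : ℝ) = √N / N ^ 2 := by
    rw [show (3 / 2 : ℝ) = 1 + 1 / 2 by norm_num, Real.rpow_add (by rw [hh]; positivity),
      Real.rpow_one, ← Real.sqrt_eq_rpow, hh, Real.sqrt_div zero_le_one, Real.sqrt_one]
    have : √(N : ℝ) ≠ 0 := (Real.sqrt_pos.2 hN').ne'
    field_simp
    nlinarith
  set μ := k / h ^ 2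
  have hEμ : E μ ≤ E μ₀ := hEmono.monotone hμ
  have hEμ0 : 0 < E μ := Real.exp_pos _
  have hsmall : 2 * √N * (E μ * (k + √N / N ^ 2)) ≤ 1 := by
    have i1 : √(N : ℝ) ≤ N := by
      have : 1 ≤ √(N : ℝ) := Real.one_le_sqrt.2 hN1
      nlinarith
    -- `k ≤ μ₀ / N²` and `√N ≤ N`, so the left-hand side is at most `2 E(μ₀) (μ₀ + 1) h`
    have i2 : √N * (k + √N / N ^ 2) ≤ (μ₀ + 1) * h := by
      have j1 : √N * k ≤ μ₀ * h := by
        have : N * k ≤ μ₀ * h := by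
          rw [hh, mul_one_div, le_div_iff₀ hN']
          nlinarith
        exact (mul_le_mul_of_nonneg_right i1 hk).trans this
      have j2 : √N * (√N / N ^ 2) = h := by
        rw [← mul_div_assoc, hsq, hh]
        field_simp
      linarith
    have i3 : E μ₀ * ((μ₀ + 1) * h) ≤ 1 / 2 := by
      rw [le_div_iff₀ (by positivity)] at hh0
      linarith
    have i4 : E μ * (√N * (k + √N / N ^ 2)) ≤ E μ₀ * ((μ₀ + 1) * h) := by gcongr
    linarith
  obtain ⟨b1, b2⟩ := hE.interp_error_bound hs hd hN hk hkT hμ' hsmall n hn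
  have ht : (n * k : ℝ) ∈ Icc 0 T := ⟨by positivity, by rw [← hkT]; gcongr⟩
  have hη' := hd.eta _ ht
  have hu' := hd.vel _ ht
  have c1 := normL2_sub_interp_le hN hη'.toHasDerivs hη'.b2 (hE.H_mem n hn)
  have c2 := normH1_sub_interp_le hN hu'.toHasDerivs hu'.b2 (hE.U_mem n hn).1
  have hs1 : 1 ≤ √(N : ℝ) := Real.one_le_sqrt.2 hN1
  have hsN : √(N : ℝ) ≤ N := by nlinarith
  rw [hh32]
  constructor
  · refine c1.trans ((add_le_add b1 le_rfl).trans ?_)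
    have : K / (N : ℝ) ^ 2 ≤ K * (√N / N ^ 2) := by
      rw [div_eq_mul_one_div]
      gcongr
    have : 0 ≤ K * (√N / (N : ℝ) ^ 2) := by positivity
    have : 0 ≤ K * k := by positivity
    linarith
  · refine c2.trans ((add_le_add b2 le_rfl).trans ?_)
    have e1 : √N / (N : ℝ) ^ 2 ≤ h := by
      rw [hh, div_le_div_iff₀ (by positivity) hN']
      nlinarith
    have e2 : E μ * (k + √N / (N : ℝ) ^ 2) ≤ E μ * (k + h) := by gcongr
    have e3 : 2 * K / N = 2 * K * h := by rw [hh]; ring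
    have : 0 ≤ K * k := by positivity
    rw [e3]
    linarith

end Boussinesq
end

theorem proposition4p1 (T : ℝ) (hT : 0 < T) (η₀ u₀ : ℝ → ℝ) (η u : ℝ → ℝ → ℝ)
    (hη : ContDiffOn ℝ 3 (fun p : ℝ × ℝ => η p.1 p.2) (Set.Icc 0 1 ×ˢ Set.Icc 0 T))
    (hu : ContDiffOn ℝ 3 (fun p : ℝ × ℝ => u p.1 p.2) (Set.Icc 0 1 ×ˢ Set.Icc 0 T)) :
    (Boussinesq.IsSolutionCB T η₀ u₀ η u →
      ∃ C : ℝ → ℝ, ContinuousOn C (Set.Ici 0) ∧ StrictMonoOn C (Set.Ici 0) ∧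
        ∀ μ₀ : ℝ, 0 < μ₀ → ∃ h₀ : ℝ, 0 < h₀ ∧
          ∀ (N M : ℕ) (h k : ℝ), 2 ≤ N → 1 ≤ M → h = 1 / N → k = T / M →
            h ≤ h₀ → k / h ^ 2 ≤ μ₀ →
            ∀ H U : ℕ → ℝ → ℝ, Boussinesq.IsEulerCB N M k η₀ u₀ H U →
              ∀ n ≤ M,
                Boussinesq.normL2 (fun x => H n x - η x (n * k))
                    ≤ C (k / h ^ 2) * (k + h ^ (3 / 2 : ℝ)) ∧
                Boussinesq.normH1 (fun x => U n x - u x (n * k))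
                    ≤ C (k / h ^ 2) * (k + h)) ∧
    (Boussinesq.IsSolutionSCB T η₀ u₀ η u →
      ∃ C : ℝ → ℝ, ContinuousOn C (Set.Ici 0) ∧ StrictMonoOn C (Set.Ici 0) ∧
        ∀ μ₀ : ℝ, 0 < μ₀ → ∃ h₀ : ℝ, 0 < h₀ ∧
          ∀ (N M : ℕ) (h k : ℝ), 2 ≤ N → 1 ≤ M → h = 1 / N → k = T / M →
            h ≤ h₀ → k / h ^ 2 ≤ μ₀ →
            ∀ H U : ℕ → ℝ → ℝ, Boussinesq.IsEulerSCB N M k η₀ u₀ H U →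
              ∀ n ≤ M,
                Boussinesq.normL2 (fun x => H n x - η x (n * k))
                    ≤ C (k / h ^ 2) * (k + h ^ (3 / 2 : ℝ)) ∧
                Boussinesq.normH1 (fun x => U n x - u x (n * k))
                    ≤ C (k / h ^ 2) * (k + h)) := by
  constructor
  · intro hs
    obtain ⟨C, hC, hC', h⟩ := hs.isSolution.exists_error_bound hT hη hu
    refine ⟨C, hC, hC', fun μ₀ hμ₀ => ?_⟩
    obtain ⟨h₀, hh₀, h⟩ := h μ₀ hμ₀
    exact ⟨h₀, hh₀, fun N M h' k h1 h2 h3 h4 h5 h6 H U hE =>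
      h N M h' k h1 h2 h3 h4 h5 h6 H U hE.isEuler⟩
  · intro hs
    obtain ⟨C, hC, hC', h⟩ := hs.isSolution.exists_error_bound hT hη hu
    refine ⟨C, hC, hC', fun μ₀ hμ₀ => ?_⟩
    obtain ⟨h₀, hh₀, h⟩ := h μ₀ hμ₀
    exact ⟨h₀, hh₀, fun N M h' k h1 h2 h3 h4 h5 h6 H U hE =>
      h N M h' k h1 h2 h3 h4 h5 h6 H U hE.isEuler⟩
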